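/- Let $\Bbbk$ be an algebraically closed field of characteristic zero, $\mathfrak g$ a finite-dimensional semisimple Lie algebra over $\Bbbk$, and $G$ its adjoint group. A pair $\mathbf e=(e_1,e_2)\in\mathfrak g\times\mathfrak g$ is called nilpotent if $[e_1,e_2]=0$ and for all $t_1,t_2\in\Bbbk^*$ there is $g\in G$ with $(g\cdot e_1,g\cdot e_2)=(t_1e_1,t_2e_2)$. Let $\mathfrak z_{\mathfrak g}(\mathbf e)=\{x\in\mathfrak g: [e_1,x]=[e_2,x]=0\}$. A characteristic of $\mathbf e$ is a pair $(h_1,h_2)$ of semisimple elements of $\mathfrak g$ with $[h_1,h_2]=0$, $[h_i,e_j]=\delta_{ij}e_j$ $(i,j\in\{1,2\})$, and $h_1,h_2$ orthogonal to $\mathfrak z_{\mathfrak g}(\mathbf e)$ with respect to the Killing form. A nilpotent pair $\mathbf e$ is called rectangular if, for a characteristic $(h_1,h_2)$ of $\mathbf e$, there are $f_1,f_2\in\mathfrak g$ such that $\{e_1,2h_1,f_1\}$ and $\{e_2,2h_2,f_2\}$ are commuting $\mathfrak{sl}_2$-triples (where the triple is zero if $e_i=0$), and principal if $\dim\mathfrak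 z_{\mathfrak g}(\mathbf e)=\operatorname{rk}\mathfrak g$. Proposition. Let $\mathbf e=(e_1,e_2)$ be a nilpotent pair in $\mathfrak g$. Suppose that there is a finite-dimensional faithful self-dual $\mathfrak g$-module $V$ (that is, $V\cong V^*$ as $\mathfrak g$-modules and no nonzero element of $\mathfrak g$ acts by zero on $V$) such that the space $V^{\langle e_1,e_2\rangle}=\{v\in V: e_1v=e_2v=0\}$ is one-dimensional. Then $\mathbf e$ is a rectangular principal nilpotent pair in $\mathfrak g$. -/

import Mathlib

/-- The adjoint group of a semisimple Lie algebra `g` over an algebraically closed field of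
characteristic zero, as a subgroup of `GL(g)`: it is generated by the (finite sums)
`exp (ad x)` with `ad x` nilpotent. -/
def adjointGroup (k g : Type*) [Field k] [LieRing g] [LieAlgebra k g] :
    Subgroup (g ≃ₗ[k] g) :=
  Subgroup.closure {φ | ∃ (x : g) (n : ℕ), (LieAlgebra.ad k g x) ^ n = 0 ∧
    ∀ y : g, φ y = ∑ i ∈ Finset.range n,
      ((Nat.factorial i : k)⁻¹) • ((LieAlgebra.ad k g x) ^ i) y}

/-- A nilpotent pair: a commuting pair whose independent rescalings are all realised by the
adjoint group. -/
structure IsNilpotentPair (k : Type*) {g : Type*} [Field k] [LieRing g] [LieAlgebra k g]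
    (e₁ e₂ : g) : Prop where
  comm : ⁅e₁, e₂⁆ = 0
  rescale : ∀ t₁ t₂ : k, t₁ ≠ 0 → t₂ ≠ 0 →
    ∃ φ ∈ adjointGroup k g, φ e₁ = t₁ • e₁ ∧ φ e₂ = t₂ • e₂

/-- The subspace of vectors of a `g`-module `V` that are annihilated by both `e₁` and `e₂`. -/
def pairFixed (k : Type*) {g : Type*} (V : Type*) [Field k] [LieRing g] [LieAlgebra k g]
    [AddCommGroup V] [Module k V] [LieRingModule g V] [LieModule k g V] (e₁ e₂ : g) :
    Submodule k V :=
  LinearMap.ker (LieModule.toEnd k g V e₁) ⊓ LinearMap.ker (LieModule.toEnd k g V e₂)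

/-- The centralizer of the pair `(e₁, e₂)` in `g`, as a subspace. -/
def pairCentralizer (k : Type*) {g : Type*} [Field k] [LieRing g] [LieAlgebra k g]
    (e₁ e₂ : g) : Submodule k g :=
  LinearMap.ker (LieAlgebra.ad k g e₁) ⊓ LinearMap.ker (LieAlgebra.ad k g e₂)

/-- `(h₁, h₂)` is a characteristic of `(e₁, e₂)`: commuting semisimple elements with
`[hᵢ, eⱼ] = δᵢⱼ eⱼ`, orthogonal to the centralizer of the pair under the Killing form. -/
structure IsCharacteristic (k : Type*) {g : Type*} [Field k] [LieRing g] [LieAlgebra k g]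
    (e₁ e₂ h₁ h₂ : g) : Prop where
  semisimple₁ : (LieAlgebra.ad k g h₁).IsSemisimple
  semisimple₂ : (LieAlgebra.ad k g h₂).IsSemisimple
  comm : ⁅h₁, h₂⁆ = 0
  lie₁₁ : ⁅h₁, e₁⁆ = e₁
  lie₁₂ : ⁅h₁, e₂⁆ = 0
  lie₂₁ : ⁅h₂, e₁⁆ = 0
  lie₂₂ : ⁅h₂, e₂⁆ = e₂
  orth₁ : ∀ z ∈ pairCentralizer k e₁ e₂, killingForm k g h₁ z = 0
  orth₂ : ∀ z ∈ pairCentralizer k e₁ e₂, killingForm k g h₂ z = 0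

/-- The relations of an `sl₂`-triple `{e, h, f}`.  The zero triple is allowed, since a member
of a nilpotent pair may vanish. -/
structure Sl2Relations {g : Type*} [LieRing g] (e h f : g) : Prop where
  lie_h_e : ⁅h, e⁆ = (2 : ℕ) • e
  lie_h_f : ⁅h, f⁆ = -((2 : ℕ) • f)
  lie_e_f : ⁅e, f⁆ = h

/-- A nilpotent pair is rectangular if, for a characteristic `(h₁, h₂)` of it, there are
elementwise commuting `sl₂`-triples `{e₁, 2h₁, f₁}` and `{e₂, 2h₂, f₂}`. -/
structure IsRectangularPair (k : Type*) {g : Type*} [Field k] [LieRing g] [LieAlgebra k g]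
    (e₁ e₂ : g) : Prop extends IsNilpotentPair k e₁ e₂ where
  triples : ∃ h₁ h₂ f₁ f₂ : g, IsCharacteristic k e₁ e₂ h₁ h₂ ∧
    Sl2Relations e₁ ((2 : ℕ) • h₁) f₁ ∧ Sl2Relations e₂ ((2 : ℕ) • h₂) f₂ ∧
    ∀ x ∈ ({e₁, (2 : ℕ) • h₁, f₁} : Set g), ∀ y ∈ ({e₂, (2 : ℕ) • h₂, f₂} : Set g), ⁅x, y⁆ = 0

/-- A nilpotent pair is principal if its centralizer has dimension equal to the rank of `g`. -/
structure IsPrincipalPair (k : Type*) {g : Type*} [Field k] [LieRing g] [LieAlgebra k g]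
    [FiniteDimensional k g] (e₁ e₂ : g) : Prop extends IsNilpotentPair k e₁ e₂ where
  finrank_centralizer : Module.finrank k (pairCentralizer k e₁ e₂) = LieAlgebra.rank k g

section

open Module LieModule
attribute [local instance 100] LieRing.ofAssociativeRing

/-! Write `E₁`, `E₂` for the operators of the pair on `V`. The rescaling by `(2, 3)` is realised by
an element of the adjoint group, hence by conjugation with some `Φ` on `V`; since the numbers `2 ^ i
* 3 ^ j` are distinct, this one operator replaces a two-dimensional torus. Self-duality turns the
one-dimensional socle into a one-dimensional cosocle, so by Nakayama `V` is cyclic over `k[E₁, E₂]`,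
with a generator `w` that can be taken to be a `Φ`-eigenvector. The nonzero monomials `E₁ ^ i E₂ ^ j
w` then have distinct `Φ`-eigenvalues, and a one-dimensional socle leaves a single maximal monomial:
they fill a rectangle (`exists_rectangular`). Thus `V` looks like the tensor product of two simple
`sl₂`-modules, which supplies weight operators `H₁`, `H₂` and lowering operators `F₁`, `F₂` in `End
k V`.

These operators must be shown to come from `g`. Each `ad Hᵢ` is a polynomial in conjugation by `Φ`,
so it preserves the image of `g` and acts there as an inner derivation `ad hᵢ`; the difference `Hᵢ -
hᵢ` is a scalar of trace zero, hence zero (`exists_toEnd_eq_weight_operators`). Duality of the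
weight spaces under the Killing form then gives `fᵢ` (`exists_toEnd_eq_lowering`). Orthogonality to
the centralizer is automatic because `2hᵢ = [eᵢ, fᵢ]`.

For principality, `ad hᵢ` has integral eigenvalues, so `sl₂`-theory applied twice equates the
dimension of the centralizer of `(e₁, e₂)` with that of `(h₁, h₂)`. The latter is the centralizer of
the single element `h₁ + (p + 1) h₂`, which has simple spectrum on `V`; it is therefore abelian, and
a semisimple element with abelian centralizer is regular (`LieAlgebra.finrank_ker_ad_eq_rank`). -/

theorem isNilpotent_of_maxGenEigenspace_eq_bot {k V : Type*} [Field k] [IsAlgClosed k]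
    [AddCommGroup V] [Module k V] [FiniteDimensional k V] {f : End k V}
    (key : ∀ μ : k, μ ≠ 0 → f.maxGenEigenspace μ = ⊥) : IsNilpotent f := by
  have h0 : f.maxGenEigenspace 0 = ⊤ := by
    rw [eq_top_iff, ← Module.End.iSup_maxGenEigenspace_eq_top f]
    refine iSup_le fun μ => ?_
    by_cases hμ : μ = 0
    · rw [hμ]
    · rw [key μ hμ]; exact bot_le
  refine ⟨f.maxGenEigenspaceIndex 0, LinearMap.ext fun v => ?_⟩
  have hv : v ∈ f.maxGenEigenspace 0 := h0 ▸ Submodule.mem_top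
  rw [Module.End.maxGenEigenspace_eq, Module.End.mem_genEigenspace_nat] at hv
  simpa using hv

/-! ### The adjoint group acts by conjugation on every representation. -/

section Rep
variable {k g V : Type*} [Field k] [LieRing g] [LieAlgebra k g]
  [AddCommGroup V] [Module k V] [LieRingModule g V] [LieModule k g V]

/-- Elements of a Lie algebra with nondegenerate Killing form act with trace zero. -/
theorem trace_toEnd_eq_zero_of_isKilling [FiniteDimensional k g] [LieAlgebra.IsKilling k g] (x : g) :
    LinearMap.trace k V (toEnd k g V x) = 0 := by
  have hnd := LieAlgebra.IsKilling.killingForm_nondegenerate k g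
  -- Represent the trace functional as `κ(a, ·)`. It kills commutators, so `κ([a, y], z) = tr [y, z]
  -- = 0`, which makes `a` central, hence zero.
  obtain ⟨a, ha⟩ := (LinearMap.BilinForm.toDual (killingForm k g) hnd).surjective
    ((LinearMap.trace k V).comp (toEnd k g V : g →ₗ[k] End k V))
  have ha' : ∀ y, killingForm k g a y = LinearMap.trace k V (toEnd k g V y) := fun y => by
    simpa [LinearMap.BilinForm.toDual_def] using! LinearMap.congr_fun ha y
  have hcomm : ∀ y : g, ⁅a, y⁆ = 0 := fun y => by
    refine (LinearMap.ker_eq_bot'.mp (LieAlgebra.IsKilling.ker_killingForm_eq_bot k g)) _ ?_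
    ext z
    rw [LieModule.traceForm_apply_lie_apply, ha', LieHom.map_lie, LinearMap.zero_apply,
      LinearMap.trace_lie]
  have : a = 0 := by
    have h : a ∈ LieAlgebra.center k g := fun y => by rw [← lie_skew, hcomm, neg_zero]
    rwa [LieAlgebra.center_eq_bot, LieSubmodule.mem_bot] at h
  rw [← ha', this]; simp

/-- In a finite-dimensional representation of a Lie algebra with nondegenerate Killing form,
an ad-nilpotent element acts nilpotently. -/
theorem isNilpotent_toEnd_of_isNilpotent_ad [CharZero k] [IsAlgClosed k] [FiniteDimensional k g]
    [FiniteDimensional k V] [LieAlgebra.IsKilling k g] {x : g} (hx : IsNilpotent (LieAlgebra.ad k g x)) :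
    IsNilpotent (toEnd k g V x) := by
  have key : ∀ μ : k, μ ≠ 0 → (toEnd k g V x).maxGenEigenspace μ = ⊥ := by
    intro μ hμ
    obtain ⟨n, hn⟩ := hx
    -- Because all of `g` is the generalized `0`-eigenspace of `ad x`, the generalized
    -- `μ`-eigenspace in `V` is a `g`-submodule. There `x` has trace `μ` times the dimension, and
    -- also trace zero.
    let N : LieSubmodule k g V :=
      { (toEnd k g V x).maxGenEigenspace μ with
        lie_mem := fun {y m} hm => by
          have hy : y ∈ (toEnd k g g x).maxGenEigenspace 0 := by
            rw [Module.End.mem_maxGenEigenspace]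
            exact ⟨n, by simpa using! LinearMap.congr_fun hn y⟩
          have := LieModule.lie_mem_maxGenEigenspace_toEnd hy hm
          rwa [zero_add] at this }
    have htr := trace_toEnd_eq_zero_of_isKilling (k := k) (V := N) x
    have hnil : IsNilpotent (toEnd k g N x - algebraMap k (End k N) μ) := by
      have hpow : ∀ (i : ℕ) (v : N), ((((toEnd k g N x - algebraMap k (End k N) μ) ^ i) v : N) : V) =
          ((toEnd k g V x - μ • (1 : End k V)) ^ i) v := fun i => by
        induction i with
        | zero => simp
        | succ i ih => intro v; rw [pow_succ, pow_succ, Module.End.mul_apply, ih]; simp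
      refine ⟨(toEnd k g V x).maxGenEigenspaceIndex μ, LinearMap.ext fun v => Subtype.ext ?_⟩
      have hv : (v : V) ∈ (toEnd k g V x).maxGenEigenspace μ := v.2
      rw [Module.End.maxGenEigenspace_eq, Module.End.mem_genEigenspace_nat] at hv
      rw [hpow]
      simpa using hv
    have htr' := (LinearMap.isNilpotent_trace_of_isNilpotent hnil).eq_zero
    rw [map_sub, htr, Algebra.algebraMap_eq_smul_one, map_smul, LinearMap.trace_one, zero_sub,
      neg_eq_zero, smul_eq_mul, mul_eq_zero, Nat.cast_eq_zero] at htr'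
    exact Submodule.finrank_eq_zero.mp (htr'.resolve_left hμ)
  exact isNilpotent_of_maxGenEigenspace_eq_bot key

/-- Conjugation by the exponential of a nilpotent element. -/
theorem exists_conj_of_isNilpotent [CharZero k] {x : g} {n : ℕ} (hn : LieAlgebra.ad k g x ^ n = 0)
    (hx : IsNilpotent (toEnd k g V x)) :
    ∃ Φ : (End k V)ˣ, ∀ y : g,
      toEnd k g V (∑ i ∈ Finset.range n, ((Nat.factorial i : k)⁻¹) • (LieAlgebra.ad k g x ^ i) y) =
        Φ * toEnd k g V y * (Φ⁻¹ : (End k V)ˣ) := by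
  let _ : Module ℚ V := Module.compHom V (algebraMap ℚ k)
  have : IsScalarTower ℚ k V := ⟨fun a b c => by
    change (a • b) • c = (algebraMap ℚ k a) • b • c
    rw [Algebra.smul_def, mul_smul]⟩
  have : SMulCommClass k ℚ V := ⟨fun a b c => by
    change a • (algebraMap ℚ k b) • c = (algebraMap ℚ k b) • a • c
    rw [smul_comm]⟩
  set a := toEnd k g V x
  refine ⟨⟨IsNilpotent.exp a, IsNilpotent.exp (-a), IsNilpotent.exp_mul_exp_neg_self hx,
    IsNilpotent.exp_neg_mul_exp_self hx⟩, fun y => ?_⟩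
  change _ = IsNilpotent.exp a * toEnd k g V y * IsNilpotent.exp (-a)
  obtain ⟨m, hm⟩ := hx
  have hl : IsNilpotent (LinearMap.mulLeft k a) :=
    (LinearMap.isNilpotent_mulLeft_iff _ _).mpr ⟨m, hm⟩
  have hr : IsNilpotent (LinearMap.mulRight k (-a)) :=
    (LinearMap.isNilpotent_mulRight_iff _ _).mpr (IsNilpotent.neg ⟨m, hm⟩)
  have hc : Commute (LinearMap.mulLeft k a) (LinearMap.mulRight k (-a)) :=
    LinearMap.commute_mulLeft_right _ _
  have hm' : (-a) ^ m = 0 := by rw [neg_pow, hm, mul_zero]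
  have e1 : IsNilpotent.exp (LinearMap.mulLeft k a) = LinearMap.mulLeft k (IsNilpotent.exp a) := by
    rw [IsNilpotent.exp_eq_sum hm, IsNilpotent.exp_eq_sum (k := m)
      (by rw [LinearMap.pow_mulLeft, hm, LinearMap.mulLeft_zero_eq_zero])]
    ext1 T
    simp [LinearMap.pow_mulLeft, Finset.sum_mul]
  have e2 : IsNilpotent.exp (LinearMap.mulRight k (-a)) =
      LinearMap.mulRight k (IsNilpotent.exp (-a)) := by
    rw [IsNilpotent.exp_eq_sum hm', IsNilpotent.exp_eq_sum (k := m)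
      (by rw [LinearMap.pow_mulRight, hm', LinearMap.mulRight_zero_eq_zero])]
    ext1 T
    simp [LinearMap.pow_mulRight, Finset.mul_sum]
  have hadd := IsNilpotent.exp_add_of_commute hc hl hr
  rw [e1, e2] at hadd
  -- The commuting nilpotents `L_a` and `R_{-a}` sum to `ad a`, so `exp (ad a)` is conjugation by
  -- `exp a`.
  have had : LinearMap.mulLeft k a + LinearMap.mulRight k (-a) = LieAlgebra.ad k (End k V) a := by
    ext1 T; simp [Ring.lie_def, sub_eq_add_neg]
  rw [had] at hadd
  have hnil : IsNilpotent (LieAlgebra.ad k (End k V) a) := LieAlgebra.ad_nilpotent_of_nilpotent ⟨m, hm⟩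
  obtain ⟨N, hN⟩ := hnil
  have hpow : ∀ (i : ℕ), (LieAlgebra.ad k (End k V) a ^ i) (toEnd k g V y) =
      toEnd k g V ((LieAlgebra.ad k g x ^ i) y) := by
    intro i
    induction i with
    | zero => simp
    | succ i ih => rw [pow_succ', pow_succ', Module.End.mul_apply, ih, Module.End.mul_apply]; simp [a]
  have hN' : LieAlgebra.ad k (End k V) a ^ (max N n) = 0 := pow_eq_zero_of_le (le_max_left _ _) hN
  have := LinearMap.congr_fun hadd (toEnd k g V y)
  rw [IsNilpotent.exp_eq_sum hN'] at this
  simp only [LinearMap.sum_apply, LinearMap.smul_apply, hpow, Module.End.mul_apply,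
    LinearMap.mulLeft_apply, LinearMap.mulRight_apply] at this
  rw [mul_assoc, ← this, map_sum]
  have hsub : Finset.range n ⊆ Finset.range (max N n) := by simp
  rw [← Finset.sum_subset hsub]
  · refine Finset.sum_congr rfl fun i _ => ?_
    rw [map_smul, ← Rat.cast_smul_eq_qsmul k]
    simp
  · intro i _ hi
    rw [pow_eq_zero_of_le (by simpa using hi) hn]; simp

/-- Every element of the adjoint group is implemented by conjugation in any finite-dimensional
representation. -/
theorem exists_conj_of_mem_adjointGroup [CharZero k] [IsAlgClosed k] [FiniteDimensional k g]
    [FiniteDimensional k V] [LieAlgebra.IsKilling k g] {φ : g ≃ₗ[k] g} (hφ : φ ∈ adjointGroup k g) :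
    ∃ Φ : (End k V)ˣ, ∀ y : g,
      toEnd k g V (φ y) = Φ * toEnd k g V y * (Φ⁻¹ : (End k V)ˣ) := by
  induction hφ using Subgroup.closure_induction with
  | mem φ h =>
    obtain ⟨x, n, hn, h⟩ := h
    obtain ⟨Φ, hΦ⟩ := exists_conj_of_isNilpotent (V := V) hn
      (isNilpotent_toEnd_of_isNilpotent_ad ⟨n, hn⟩)
    exact ⟨Φ, fun y => by rw [h, hΦ]⟩
  | one => exact ⟨1, fun y => by simp⟩
  | mul φ ψ _ _ h1 h2 =>
    obtain ⟨Φ, hΦ⟩ := h1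
    obtain ⟨Ψ, hΨ⟩ := h2
    exact ⟨Φ * Ψ, fun y => by rw [LinearEquiv.mul_apply, hΦ, hΨ]; simp [mul_assoc]⟩
  | inv φ _ h =>
    obtain ⟨Φ, hΦ⟩ := h
    refine ⟨Φ⁻¹, fun y => ?_⟩
    have := hΦ (φ⁻¹ y)
    rw [show φ (φ⁻¹ y) = y from φ.apply_symm_apply y] at this
    rw [this]; simp [mul_assoc]

end Rep

/-! ### Finite-dimensional `sl₂`-theory, with `h` half the usual weight operator. -/

/-- Operators `E, h, F` such that `E, 2h, F` satisfy the relations of an `sl₂`-triple. -/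
structure IsSl2Operators {k W : Type*} [Field k] [AddCommGroup W] [Module k W]
    (E h F : End k W) : Prop where
  hE : ∀ x, h (E x) = E (h x) + E x
  hF : ∀ x, h (F x) = F (h x) - F x
  EF : ∀ x, E (F x) = F (E x) + (2 : k) • h x

namespace IsSl2Operators
variable {k W : Type*} [Field k] [AddCommGroup W] [Module k W] {E h F : End k W}

theorem symm (s : IsSl2Operators E h F) : IsSl2Operators F (-h) E where
  hE x := by simp only [LinearMap.neg_apply, s.hF, map_neg]; abel
  hF x := by simp only [LinearMap.neg_apply, s.hE, map_neg]; abel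
  EF x := by rw [s.EF]; simp

theorem restrict (s : IsSl2Operators E h F) {S : Submodule k W} (hE : ∀ x ∈ S, E x ∈ S)
    (hh : ∀ x ∈ S, h x ∈ S) (hF : ∀ x ∈ S, F x ∈ S) :
    IsSl2Operators (E.restrict hE) (h.restrict hh) (F.restrict hF) where
  hE x := Subtype.ext (s.hE x)
  hF x := Subtype.ext (s.hF x)
  EF x := Subtype.ext (s.EF x)

variable [CharZero k]

/-- `F E` is injective on the negative weight spaces. -/
theorem eq_zero_of_neg [FiniteDimensional k W] (s : IsSl2Operators E h F) {x : W} {m : ℕ}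
    (hm : 0 < m) (hx : h x = -(m : k) • x) (hFE : F (E x) = 0) : x = 0 := by
  by_contra hne
  have hw : ∀ n : ℕ, h ((F ^ n) x) = -((m : k) + n) • (F ^ n) x := by
    intro n
    induction n with
    | zero => simpa using hx
    | succ n ih =>
      rw [pow_succ', Module.End.mul_apply, s.hF, ih, map_smul]; push_cast; module
  -- The scalar `-(n + 1)(2m + n)` is never zero when `m > 0`, so the string of vectors `F ^ n x`
  -- would never end and would produce infinitely many weights.
  have hEF : ∀ n : ℕ, E (F ((F ^ n) x)) = -(((n : k) + 1) * (2 * m + n)) • (F ^ n) x := by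
    intro n
    induction n with
    | zero => rw [s.EF]; simp [hFE, hx, smul_smul]
    | succ n ih =>
      rw [s.EF, hw, pow_succ', Module.End.mul_apply, ih, map_smul]; push_cast; module
  have hnz : ∀ n : ℕ, (F ^ n) x ≠ 0 := by
    intro n
    induction n with
    | zero => simpa using hne
    | succ n ih =>
      rw [pow_succ', Module.End.mul_apply]
      intro h0
      have := hEF n
      rw [h0, map_zero, eq_comm, smul_eq_zero, neg_eq_zero] at this
      have h1 := this.resolve_right ih
      norm_cast at h1
      simp at h1
      omega
  have hli := Module.End.eigenvectors_linearIndependent' h (fun n : ℕ => -((m : k) + n))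
    (fun a b hab => by simpa using hab) (fun n => (F ^ n) x)
    (fun n => ⟨Module.End.mem_eigenspace_iff.mpr (hw n), hnz n⟩)
  exact not_finite_iff_infinite.mpr inferInstance hli.finite

/-- `E` maps onto each positive weight space. -/
theorem exists_of_pos [FiniteDimensional k W] (s : IsSl2Operators E h F) {y : W} {m : ℕ}
    (hm : 0 < m) (hy : h y = (m : k) • y) : ∃ z, h z = ((m : k) - 1) • z ∧ E z = y := by
  -- `E F` acts on the weight space. The previous lemma with `E` and `F` exchanged makes it
  -- injective there, hence surjective, and `F u` supplies the preimage.
  have hst : ∀ x ∈ h.eigenspace (m : k), (E * F) x ∈ h.eigenspace (m : k) := fun x hx => by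
    rw [Module.End.mem_eigenspace_iff] at hx ⊢
    rw [Module.End.mul_apply, s.hE, s.hF, hx]; simp
  have hinj : Function.Injective ((E * F).restrict hst) := by
    rw [← LinearMap.ker_eq_bot, LinearMap.ker_eq_bot']
    rintro ⟨x, hx⟩ h0
    rw [Module.End.mem_eigenspace_iff] at hx
    refine Subtype.ext (s.symm.eq_zero_of_neg hm ?_ (Subtype.ext_iff.mp h0))
    rw [LinearMap.neg_apply, hx, neg_smul]
  obtain ⟨⟨u, hu⟩, hu'⟩ := (LinearMap.injective_iff_surjective.mp hinj)
    ⟨y, Module.End.mem_eigenspace_iff.mpr hy⟩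
  rw [Module.End.mem_eigenspace_iff] at hu
  refine ⟨F u, ?_, Subtype.ext_iff.mp hu'⟩
  rw [s.hF, hu, map_smul]; module

/-- If all weights of `h` are integral, there are as many highest weight vectors as vectors of
weight zero. -/
theorem finrank_ker_eq [FiniteDimensional k W] (s : IsSl2Operators E h F)
    (htop : ⨆ μ, h.eigenspace μ = ⊤) (hint : ∀ μ, h.HasEigenvalue μ → ∃ n : ℤ, μ = n) :
    finrank k (LinearMap.ker E) = finrank k (LinearMap.ker h) := by
  -- `P` and `Q` collect the weights `≥ 0` and `≥ 1`. Then `ker E ≤ P`, `E` maps `P` onto `Q`, and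
  -- `P = ker h ⊕ Q`; counting dimensions gives the claim.
  set P : Submodule k W := ⨆ n : ℕ, h.eigenspace (n : k) with hP
  set Q : Submodule k W := ⨆ n : ℕ, h.eigenspace ((n : k) + 1) with hQ
  have hker : LinearMap.ker E ≤ P := by
    rw [Submodule.eq_iSup_inf_genEigenspace (f := h) (p := LinearMap.ker E) 1 (fun x hx => by
      rw [LinearMap.mem_ker] at hx ⊢
      have := s.hE x
      rw [hx, map_zero, add_zero] at this
      exact this.symm) htop]
    refine iSup_le fun μ => ?_
    intro x ⟨hx, hxμ⟩
    by_cases h0 : x = 0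
    · rw [h0]; exact zero_mem _
    · change x ∈ h.eigenspace μ at hxμ
      obtain ⟨n, rfl⟩ := hint μ (Module.End.hasEigenvalue_of_hasEigenvector ⟨hxμ, h0⟩)
      rcases lt_or_ge n 0 with hn | hn
      · refine absurd (s.eq_zero_of_neg (m := (-n).toNat) (by omega) ?_
          (by rw [LinearMap.mem_ker.mp hx, map_zero])) h0
        rw [Module.End.mem_eigenspace_iff.mp hxμ, ← Int.cast_natCast, Int.toNat_of_nonneg (by omega)]
        simp
      · obtain ⟨m, rfl⟩ := Int.eq_ofNat_of_zero_le hn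
        exact Submodule.mem_iSup_of_mem m (by simpa using hxμ)
  have hPQ : P = LinearMap.ker h ⊔ Q := by
    rw [hP, ← sup_iSup_nat_succ]
    simp [Module.End.eigenspace_zero, hQ]
  have hdisj : Disjoint (LinearMap.ker h) Q := by
    have hi := (Module.End.eigenspaces_iSupIndep h) 0
    rw [Module.End.eigenspace_zero] at hi
    refine hi.mono_right (iSup_le fun n => ?_)
    exact le_iSup₂_of_le ((n : k) + 1) (Nat.cast_add_one_ne_zero n) le_rfl
  have hmap : P.map E = Q := by
    rw [hP, hQ, Submodule.map_iSup]
    refine iSup_congr fun n => le_antisymm ?_ ?_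
    · rintro _ ⟨x, hx, rfl⟩
      rw [SetLike.mem_coe, Module.End.mem_eigenspace_iff] at hx
      rw [Module.End.mem_eigenspace_iff, s.hE, hx, map_smul]; module
    · intro y hy
      rw [Module.End.mem_eigenspace_iff] at hy
      obtain ⟨z, hz, rfl⟩ := s.exists_of_pos (m := n + 1) (Nat.succ_pos n) (by simpa using hy)
      exact ⟨z, by simpa [Module.End.mem_eigenspace_iff] using hz, rfl⟩
  have h1 := LinearMap.finrank_range_add_finrank_ker (E.domRestrict P)
  rw [LinearMap.range_domRestrict, hmap, LinearMap.ker_domRestrict] at h1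
  have h2 : finrank k ((LinearMap.ker E).submoduleOf P) = finrank k (LinearMap.ker E) :=
    (Submodule.submoduleOfEquivOfLe hker).finrank_eq
  have h3 := Submodule.finrank_sup_add_finrank_inf_eq (LinearMap.ker h) Q
  rw [hdisj.eq_bot, finrank_bot, ← hPQ] at h3
  rw [Submodule.submoduleOf] at h2
  omega

/-- Relative version of `IsSl2Operators.finrank_ker_eq` for an invariant subspace. -/
theorem finrank_ker_inf_eq [FiniteDimensional k W] (s : IsSl2Operators E h F)
    (htop : ⨆ μ, h.eigenspace μ = ⊤) (hint : ∀ μ, h.HasEigenvalue μ → ∃ n : ℤ, μ = n)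
    {S : Submodule k W} (hE : ∀ x ∈ S, E x ∈ S)
    (hh : ∀ x ∈ S, h x ∈ S) (hF : ∀ x ∈ S, F x ∈ S) :
    finrank k (LinearMap.ker E ⊓ S : Submodule k W) =
      finrank k (LinearMap.ker h ⊓ S : Submodule k W) := by
  have key : ∀ (f : End k W) (hf : ∀ x ∈ S, f x ∈ S),
      finrank k (LinearMap.ker (f.restrict hf)) =
        finrank k (LinearMap.ker f ⊓ S : Submodule k W) := fun f hf => by
    have : LinearMap.ker (f.restrict hf) = (LinearMap.ker f ⊓ S).submoduleOf S := by
      ext x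
      simp [Submodule.submoduleOf, Subtype.ext_iff]
    rw [this]
    exact (Submodule.submoduleOfEquivOfLe inf_le_right).finrank_eq
  rw [← key E hE, ← key h hh]
  refine (s.restrict hE hh hF).finrank_ker_eq
    (Module.End.genEigenspace_restrict_eq_top hh (k := 1) htop) fun μ hμ => hint μ ?_
  obtain ⟨x, hx⟩ := hμ.exists_hasEigenvector
  refine Module.End.hasEigenvalue_of_hasEigenvector (x := (x : W)) ⟨?_, ?_⟩
  · rw [Module.End.mem_eigenspace_iff]
    exact Subtype.ext_iff.mp (Module.End.mem_eigenspace_iff.mp hx.1)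
  · simpa using hx.2

/-- A vector of weight `-1` killed by `E ^ 2` vanishes. -/
theorem eq_zero_of_weight_neg_one [FiniteDimensional k W] (s : IsSl2Operators E h F) {x : W}
    (hx : h x = -x) (hEE : E (E x) = 0) : x = 0 := by
  refine s.eq_zero_of_neg (m := 1) one_pos (by simpa using hx) ?_
  have h0 : h (E x) = 0 := by rw [s.hE, hx]; simp
  -- The same injectivity is now applied to `F (E x)`, again of weight `-1`: `E` kills it, since `E
  -- x` has weight zero and `E (E x) = 0`.
  refine s.eq_zero_of_neg (m := 1) one_pos (by rw [s.hF, h0]; simp) ?_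
  rw [s.EF, hEE, h0]; simp

end IsSl2Operators

/-! ### Polynomials vanishing along curves, and polynomial curves. -/

namespace MvPolynomial

theorem aeval_mul_eq_of_isHomogeneous {σ R A : Type*} [CommRing R] [CommRing A] [Algebra R A]
    {φ : MvPolynomial σ R} {n : ℕ} (hφ : φ.IsHomogeneous n) (r : A) (u : σ → A) :
    MvPolynomial.aeval (fun i => r * u i) φ = r ^ n * MvPolynomial.aeval u φ := by
  rw [aeval_def, aeval_def, eval₂_eq, eval₂_eq, Finset.mul_sum]
  refine Finset.sum_congr rfl fun d hd => ?_
  have hdeg := hφ (mem_support_iff.mp hd)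
  have h2 : ∑ i ∈ d.support, d i = n := by
    rw [← hdeg, Finsupp.weight_apply]; simp [Finsupp.sum]
  simp_rw [mul_pow]
  rw [Finset.prod_mul_distrib, Finset.prod_pow_eq_pow_sum, h2]
  ring

/-- A polynomial vanishing along curves through a fixed point in all directions is zero. -/
theorem eq_zero_of_curves {ι k : Type*} [Field k] [Infinite k]
    (P : MvPolynomial ι k) (x : ι → k)
    (hP : ∀ v : ι → k, ∃ w : ι → Polynomial k,
      aeval (fun i => Polynomial.C (x i) + Polynomial.X * (Polynomial.C (v i) +
        Polynomial.X * w i)) P = 0) : P = 0 := by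
  classical
  set Q : MvPolynomial ι k := aeval (fun i => X i + C (x i)) P with hQ
  have hcomp : ∀ u : ι → Polynomial k,
      aeval u Q = aeval (fun i => Polynomial.C (x i) + u i) P := by
    intro u
    rw [hQ, ← AlgHom.comp_apply, comp_aeval]
    simp [add_comm, Polynomial.algebraMap_eq]
  have hPQ : P = aeval (fun i => X i - C (x i)) Q := by
    rw [hQ, ← AlgHom.comp_apply, comp_aeval]
    simp
  -- Along a curve with initial velocity `v`, once the components of `Q` below degree `m` vanish,
  -- the coefficient of `X ^ m` is the degree `m` component evaluated at `v`.
  have hall : ∀ m, homogeneousComponent m Q = 0 := by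
    intro m
    induction m using Nat.strong_induction_on with
    | _ m ih =>
    refine (homogeneousComponent_isHomogeneous m Q).eq_zero_of_forall_eval_eq_zero fun v => ?_
    obtain ⟨w, hw⟩ := hP v
    rw [← hcomp (fun i => Polynomial.X * (Polynomial.C (v i) + Polynomial.X * w i))] at hw
    set u : ι → Polynomial k := fun i => Polynomial.C (v i) + Polynomial.X * w i with hu
    have hsum : ∑ j ∈ Finset.range (Q.totalDegree + 1 + m + 1),
        Polynomial.X ^ j * aeval u (homogeneousComponent j Q) = 0 := by
      rw [← hw]
      conv_rhs => rw [← sum_homogeneousComponent Q, map_sum]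
      rw [← Finset.sum_subset (Finset.range_subset_range.mpr
        (show Q.totalDegree + 1 ≤ Q.totalDegree + 1 + m + 1 by omega))]
      · exact Finset.sum_congr rfl fun j _ =>
          (aeval_mul_eq_of_isHomogeneous (homogeneousComponent_isHomogeneous j Q) _ _).symm
      · intro j _ hj
        rw [homogeneousComponent_eq_zero _ _ (by simpa using hj)]; simp
    have hcoeff := congrArg (fun q => Polynomial.coeff q m) hsum
    simp only [Polynomial.finsetSum_coeff, Polynomial.coeff_zero] at hcoeff
    rw [Finset.sum_eq_single m] at hcoeff
    · rw [Polynomial.coeff_X_pow_mul', if_pos le_rfl, Nat.sub_self,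
        Polynomial.coeff_zero_eq_eval_zero] at hcoeff
      rw [← hcoeff, ← Polynomial.coe_aeval_eq_eval, ← AlgHom.comp_apply,
        comp_aeval]
      simp [hu, aeval_eq_eval]
    · intro j _ hjm
      rcases lt_or_gt_of_ne hjm with h | h
      · rw [ih j h]; simp
      · rw [Polynomial.coeff_X_pow_mul', if_neg (by omega)]
    · intro h; simp at h
  have : Q = 0 := by rw [← sum_homogeneousComponent Q]; simp [hall]
  rw [hPQ, this, map_zero]

end MvPolynomial

/-- A map from the base field to a vector space with polynomial coordinates. -/
def IsPolynomialCurve {k g : Type*} [Field k] [AddCommGroup g] [Module k g] (w : k → g) : Prop :=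
  ∀ f : Dual k g, ∃ p : Polynomial k, ∀ s, f (w s) = p.eval s

namespace IsPolynomialCurve
variable {k g : Type*} [Field k] [AddCommGroup g] [Module k g] {w w' : k → g}

theorem const (a : g) : IsPolynomialCurve (fun _ : k => a) :=
  fun f => ⟨Polynomial.C (f a), fun s => by simp⟩

theorem add (h : IsPolynomialCurve w) (h' : IsPolynomialCurve w') :
    IsPolynomialCurve (fun s => w s + w' s) := fun f => by
  obtain ⟨p, hp⟩ := h f
  obtain ⟨q, hq⟩ := h' f
  exact ⟨p + q, fun s => by simp [hp, hq]⟩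

theorem smul (h : IsPolynomialCurve w) (q : Polynomial k) :
    IsPolynomialCurve (fun s => q.eval s • w s) := fun f => by
  obtain ⟨p, hp⟩ := h f
  exact ⟨q * p, fun s => by simp [hp]⟩

theorem map (h : IsPolynomialCurve w) (L : End k g) : IsPolynomialCurve (fun s => L (w s)) :=
  fun f => h (f ∘ₗ L)

theorem sum {ι : Type*} {S : Finset ι} {u : ι → k → g} (h : ∀ i, IsPolynomialCurve (u i)) :
    IsPolynomialCurve (fun s => ∑ i ∈ S, u i s) := fun f => by
  choose p hp using fun i => h i f
  exact ⟨∑ i ∈ S, p i, fun s => by simp [Polynomial.eval_finsetSum, hp]⟩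

end IsPolynomialCurve

/-! ### Semisimple elements with abelian centralizer are regular. -/

section Rank
variable {k g : Type*} [Field k] [CharZero k] [LieRing g] [LieAlgebra k g]

/-- Moving a curve by the one-parameter group of an ad-nilpotent element. -/
theorem exists_curve_of_isNilpotent_ad {F : g → Prop}
    (hF : ∀ (z y : g) (n : ℕ), LieAlgebra.ad k g z ^ n = 0 → F y →
      F (∑ i ∈ Finset.range n, ((Nat.factorial i : k)⁻¹) • (LieAlgebra.ad k g z ^ i) y))
    {x v z : g} (hz : IsNilpotent (LieAlgebra.ad k g z))
    (hv : ∃ w : k → g, IsPolynomialCurve w ∧ ∀ s : k, F (x + s • (v + s • w s))) :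
    ∃ w : k → g, IsPolynomialCurve w ∧ ∀ s : k, F (x + s • ((v + ⁅z, x⁆) + s • w s)) := by
  obtain ⟨w, hw, hwF⟩ := hv
  obtain ⟨n, hn⟩ := hz
  set A := LieAlgebra.ad k g z with hA
  have hS : IsPolynomialCurve (fun s : k => x + s • (v + s • w s)) := by
    have h1 := (hw.smul Polynomial.X)
    have h2 := ((IsPolynomialCurve.const v).add h1).smul Polynomial.X
    simpa using (IsPolynomialCurve.const x).add h2
  -- This is the expansion of `exp (s • ad z)` applied to the old curve: the terms of order 0 and 1
  -- in `s` are `x + s(v + [z, x])`, and the rest divided by `s ^ 2` is the new remainder.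
  refine ⟨fun s => (w s + A v) + s • A (w s) + ∑ i ∈ Finset.range n,
      (s ^ i * ((i + 2).factorial : k)⁻¹) • (A ^ (i + 2)) (x + s • (v + s • w s)), ?_, fun s => ?_⟩
  · refine ((hw.add (IsPolynomialCurve.const _)).add ?_).add (IsPolynomialCurve.sum fun i => ?_)
    · simpa using (hw.map A).smul Polynomial.X
    · have := (hS.map (A ^ (i + 2))).smul
        (Polynomial.X ^ i * Polynomial.C ((i + 2).factorial : k)⁻¹)
      simpa only [Polynomial.eval_mul, Polynomial.eval_pow, Polynomial.eval_X,
        Polynomial.eval_C] using this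
  · have hsz : LieAlgebra.ad k g (s • z) ^ (n + 2) = 0 := by
      rw [map_smul, smul_pow, ← hA, pow_add A, hn, zero_mul, smul_zero]
    have := hF (s • z) _ (n + 2) hsz (hwF s)
    convert! this using 1
    rw [Finset.sum_range_succ', Finset.sum_range_succ', map_smul, ← hA]
    set S := x + s • (v + s • w s) with hSdef
    have hsum : ∑ i ∈ Finset.range n, (((i + 1 + 1).factorial : k)⁻¹) • ((s • A) ^ (i + 1 + 1)) S =
        (s * s) • ∑ i ∈ Finset.range n,
          (s ^ i * ((i + 2).factorial : k)⁻¹) • (A ^ (i + 2)) S := by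
      rw [Finset.smul_sum]
      refine Finset.sum_congr rfl fun i _ => ?_
      rw [smul_pow, LinearMap.smul_apply, smul_smul, smul_smul]
      congr 1
      ring
    have hone : (((0 + 1).factorial : k)⁻¹) • ((s • A) ^ (0 + 1)) S =
        s • A x + (s * s) • A v + (s * s * s) • A (w s) := by
      simp only [zero_add, Nat.factorial_one, Nat.cast_one, inv_one, pow_one, one_smul,
        LinearMap.smul_apply, hSdef, map_add, map_smul]
      module
    have hzero : ((Nat.factorial 0 : k)⁻¹) • ((s • A) ^ 0) S = x + s • v + (s * s) • w s := by
      simp only [Nat.factorial_zero, Nat.cast_one, inv_one, pow_zero, one_smul,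
        Module.End.one_apply, hSdef]
      module
    rw [hsum, hone, hzero, show ⁅z, x⁆ = A x from rfl]
    module

/-- `ad z` shifts the eigenvalues of `ad x` by `μ`, and in characteristic zero the shifts `ν + n μ`
are all distinct, so only finitely many can occur. -/
theorem isNilpotent_ad_of_mem_eigenspace [FiniteDimensional k g] {x z : g} {μ : k} (hμ : μ ≠ 0)
    (htop : ⨆ ν, (LieAlgebra.ad k g x).eigenspace ν = ⊤)
    (hz : ⁅x, z⁆ = μ • z) : IsNilpotent (LieAlgebra.ad k g z) := by
  rw [Module.End.isNilpotent_iff_of_finite]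
  intro y
  have hy : y ∈ ⨆ ν, (LieAlgebra.ad k g x).eigenspace ν := htop ▸ Submodule.mem_top
  induction hy using Submodule.iSup_induction' with
  | mem ν y hy =>
    by_contra! hcon
    rw [Module.End.mem_eigenspace_iff, LieAlgebra.ad_apply] at hy
    have hw : ∀ n : ℕ, ⁅x, (LieAlgebra.ad k g z ^ n) y⁆ =
        (ν + n * μ) • (LieAlgebra.ad k g z ^ n) y := by
      intro n
      induction n with
      | zero => simpa using hy
      | succ n ih =>
        rw [pow_succ', Module.End.mul_apply, LieAlgebra.ad_apply, leibniz_lie, hz, ih, lie_smul,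
          smul_lie]
        push_cast; module
    have hli := Module.End.eigenvectors_linearIndependent' (LieAlgebra.ad k g x)
      (fun n : ℕ => ν + n * μ) (fun a b hab => by simpa [hμ] using hab) _
      (fun n => ⟨Module.End.mem_eigenspace_iff.mpr (hw n), hcon n⟩)
    exact not_finite_iff_infinite.mpr inferInstance hli.finite
  | zero => exact ⟨0, by simp⟩
  | add a b _ _ ha hb =>
    obtain ⟨m, hm⟩ := ha
    obtain ⟨n, hn⟩ := hb
    refine ⟨m + n, ?_⟩
    rw [map_add, pow_add, Module.End.mul_apply, Module.End.mul_apply, hn, map_zero, add_zero,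
      ← Module.End.mul_apply, ← pow_add, add_comm, pow_add, Module.End.mul_apply, hm, map_zero]

/-- If the abelian centralizer `t` of `x` had dimension above the rank, the generic coefficient
defining the rank would vanish on `t`, hence, by invariance, on its conjugates. These sweep out
every tangent direction at `x`, because `g = t + [g, x]`, so the coefficient would vanish
identically. The other inequality holds for the Engel subalgebra of any element. -/
theorem LieAlgebra.finrank_ker_ad_eq_rank [IsAlgClosed k] [FiniteDimensional k g] {x : g}
    (hx : (LieAlgebra.ad k g x).IsSemisimple)
    (hab : ∀ a b : g, ⁅x, a⁆ = 0 → ⁅x, b⁆ = 0 → ⁅a, b⁆ = 0) :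
    finrank k (LinearMap.ker (LieAlgebra.ad k g x)) = LieAlgebra.rank k g := by
  have heig : ∀ μ, (LieAlgebra.ad k g x).maxGenEigenspace μ = (LieAlgebra.ad k g x).eigenspace μ :=
    fun μ => hx.isFinitelySemisimple.maxGenEigenspace_eq_eigenspace μ
  have htop : ⨆ ν, (LieAlgebra.ad k g x).eigenspace ν = ⊤ := by
    simp_rw [← heig]; exact Module.End.iSup_maxGenEigenspace_eq_top _
  refine le_antisymm ?_ ?_
  · by_contra! hlt
    set b := Module.Free.chooseBasis k g
    set P := (LinearMap.polyCharpoly (LieAlgebra.ad k g : g →ₗ[k] End k g) b).coeff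
      (LieAlgebra.rank k g) with hP
    have hP0 : P ≠ 0 := LieAlgebra.polyCharpoly_coeff_rank_ne_zero k g b
    refine hP0 ?_
    set F : g → Prop := fun y => (LieAlgebra.ad k g y).charpoly.coeff (LieAlgebra.rank k g) = 0
      with hF
    have hFP : ∀ y, F y ↔ MvPolynomial.eval (b.repr y) P = 0 := fun y => by
      rw [hP, LinearMap.polyCharpoly_coeff_eval]; rfl
    have hFT : ∀ y, ⁅x, y⁆ = 0 → F y := by
      intro y hy
      refine Polynomial.coeff_eq_zero_of_lt_natTrailingDegree ?_
      rw [← LinearMap.finrank_maxGenEigenspace_zero_eq]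
      refine hlt.trans_le (Submodule.finrank_mono fun a ha => ?_)
      rw [Module.End.mem_maxGenEigenspace]
      exact ⟨1, by simpa using hab y a hy ha⟩
    have hFinv : ∀ (z y : g) (n : ℕ), LieAlgebra.ad k g z ^ n = 0 → F y →
        F (∑ i ∈ Finset.range n, ((Nat.factorial i : k)⁻¹) • (LieAlgebra.ad k g z ^ i) y) := by
      intro z y n hn hy
      obtain ⟨Φ, hΦ⟩ := exists_conj_of_isNilpotent (V := g) hn ⟨n, hn⟩
      have := hΦ y
      simp only [hF] at hy ⊢
      rw [← hy]
      congr 1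
      change (toEnd k g g _).charpoly = (toEnd k g g y).charpoly
      rw [this]
      exact LinearEquiv.charpoly_conj (LinearMap.GeneralLinearGroup.generalLinearEquiv k g Φ) _
    have hadm : ∀ v : g, ∃ w : k → g, IsPolynomialCurve w ∧
        ∀ s : k, F (x + s • (v + s • w s)) := by
      -- Here `τ` is the component of `u` in the centralizer of `x`. An eigenvector `u` with `ν ≠ 0`
      -- equals `[z, x]` for the ad-nilpotent `z = -ν⁻¹ u`, so moving the curve by `z` adds `u` to
      -- its velocity.
      have hstep : ∀ u : g, ∃ τ : g, ⁅x, τ⁆ = 0 ∧ ∀ v : g, (∃ w : k → g, IsPolynomialCurve w ∧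
          ∀ s : k, F (x + s • (v + s • w s))) → ∃ w : k → g, IsPolynomialCurve w ∧
          ∀ s : k, F (x + s • ((v + (u - τ)) + s • w s)) := by
        intro u
        have hu : u ∈ ⨆ ν, (LieAlgebra.ad k g x).eigenspace ν := htop ▸ Submodule.mem_top
        induction hu using Submodule.iSup_induction' with
        | mem ν u hu =>
          rw [Module.End.mem_eigenspace_iff, LieAlgebra.ad_apply] at hu
          by_cases hν : ν = 0
          · exact ⟨u, by rw [hu, hν, zero_smul], fun v hv => by simpa using hv⟩
          · refine ⟨0, lie_zero _, fun v hv => ?_⟩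
            have hz : ⁅x, -(ν⁻¹ • u)⁆ = ν • -(ν⁻¹ • u) := by
              rw [lie_neg, lie_smul, hu]; module
            have := exists_curve_of_isNilpotent_ad hFinv
              (isNilpotent_ad_of_mem_eigenspace hν htop hz) hv
            rwa [← lie_skew, hz, smul_neg, neg_neg, smul_smul, mul_inv_cancel₀ hν, one_smul,
              ← sub_zero u] at this
        | zero => exact ⟨0, lie_zero _, fun v hv => by simpa using hv⟩
        | add a b _ _ ha hb =>
          obtain ⟨τ, hτ, h1⟩ := ha
          obtain ⟨σ, hσ, h2⟩ := hb
          refine ⟨τ + σ, by rw [lie_add, hτ, hσ, add_zero], fun v hv => ?_⟩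
          have := h2 _ (h1 v hv)
          rwa [show v + (a - τ) + (b - σ) = v + (a + b - (τ + σ)) by abel] at this
      intro u
      obtain ⟨τ, hτ, h⟩ := hstep u
      have := h τ ⟨fun _ => 0, IsPolynomialCurve.const 0, fun s => hFT _ (by simp [hτ])⟩
      rwa [add_sub_cancel] at this
    refine MvPolynomial.eq_zero_of_curves P (b.repr x) fun v => ?_
    obtain ⟨w, hw, hwF⟩ := hadm (b.equivFun.symm v)
    choose q hq using fun i => hw (b.coord i)
    refine ⟨q, Polynomial.funext fun s => ?_⟩
    have h1 := (hFP _).mp (hwF s)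
    rw [Polynomial.eval_zero, ← h1, ← Polynomial.coe_aeval_eq_eval, ← AlgHom.comp_apply,
      MvPolynomial.comp_aeval, MvPolynomial.aeval_eq_eval]
    congr 1
    congr 1
    funext i
    have h2 : b.repr (b.equivFun.symm v) i = v i := by
      rw [← Basis.equivFun_apply, LinearEquiv.apply_symm_apply]
    have h3 : b.repr (w s) i = (q i).eval s := hq i s
    have h4 : b.repr (x + s • (b.equivFun.symm v + s • w s)) i =
        b.repr x i + s * (v i + s * (q i).eval s) := by
      rw [map_add, map_smul, map_add, map_smul, Finsupp.add_apply, Finsupp.smul_apply,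
        Finsupp.add_apply, Finsupp.smul_apply, h2, h3, smul_eq_mul, smul_eq_mul]
    rw [h4]
    simp
  · refine (LieAlgebra.rank_le_finrank_engel k x).trans ?_
    rw [← Module.End.eigenspace_zero, ← heig]
    exact le_rfl

end Rank

/-! ### Rescalable commuting pairs and rectangular monomial bases. -/

section Bigraded
variable {k V : Type*} [Field k] [AddCommGroup V] [Module k V]

/-- Lets the single rescaling by `(2, 3)` detect both exponents of a monomial. -/
theorem two_pow_mul_three_pow_injective {i j i' j' : ℕ} (h : 2 ^ i * 3 ^ j = 2 ^ i' * 3 ^ j') :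
    i = i' ∧ j = j' := by
  have h2 := congrArg (padicValNat 2) h
  have h3 := congrArg (padicValNat 3) h
  have : Fact (Nat.Prime 3) := ⟨Nat.prime_three⟩
  have e23 : padicValNat 2 3 = 0 := padicValNat.eq_zero_of_not_dvd (by norm_num)
  have e32 : padicValNat 3 2 = 0 := padicValNat.eq_zero_of_not_dvd (by norm_num)
  simp only [padicValNat.mul (pow_ne_zero _ (two_ne_zero (α := ℕ)))
    (pow_ne_zero _ (three_ne_zero (α := ℕ))), padicValNat.pow, padicValNat.self one_lt_two,
    padicValNat.self (show 1 < 3 by norm_num), e23, e32] at h2 h3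
  omega

theorem cast_two_pow_mul_three_pow_injective [CharZero k] {i j i' j' : ℕ}
    (h : (2 : k) ^ i * 3 ^ j = 2 ^ i' * 3 ^ j') : i = i' ∧ j = j' :=
  two_pow_mul_three_pow_injective (by exact_mod_cast h)

/-- An operator that is conjugate to a proper multiple of itself is nilpotent. -/
theorem isNilpotent_of_rescaling [IsAlgClosed k] [FiniteDimensional k V] {E : End k V}
    (Φ : (End k V)ˣ) {t : k} (ht0 : t ≠ 0) (ht : Function.Injective (fun n : ℕ => t ^ n))
    (h : ∀ v, (Φ : End k V) (E v) = t • E ((Φ : End k V) v)) : IsNilpotent E := by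
  refine isNilpotent_of_maxGenEigenspace_eq_bot fun μ hμ => ?_
  by_contra hne
  have hev : E.HasEigenvalue μ := by
    rw [Module.End.hasEigenvalue_iff]
    intro h0
    refine hne ?_
    rw [Module.End.maxGenEigenspace_eq]
    by_contra hgen
    exact Module.End.hasEigenvalue_of_hasGenEigenvalue (k := E.maxGenEigenspaceIndex μ)
      hgen h0
  obtain ⟨v, hv⟩ := hev.exists_hasEigenvector
  -- A nonzero eigenvalue `μ` would force all the distinct values `μ t⁻ⁿ` to be eigenvalues.
  have hΦ : ∀ n : ℕ, E (((Φ : End k V) ^ n) v) = (μ * t⁻¹ ^ n) • ((Φ : End k V) ^ n) v := by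
    intro n
    induction n with
    | zero => simpa using hv.apply_eq_smul
    | succ n ih =>
      have := h (((Φ : End k V) ^ n) v)
      rw [ih, map_smul] at this
      rw [pow_succ' (Φ : End k V), Module.End.mul_apply,
        ← inv_smul_smul₀ ht0 (E ((Φ : End k V) (((Φ : End k V) ^ n) v))), ← this, smul_smul]
      congr 1
      ring
  have hinj : Function.Injective (Φ : End k V) := fun a b hab => by
    have := congrArg ((Φ⁻¹ : (End k V)ˣ) : End k V) hab
    simpa [← Module.End.mul_apply] using this
  have hnz : ∀ n : ℕ, ((Φ : End k V) ^ n) v ≠ 0 := by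
    intro n
    induction n with
    | zero => simpa using hv.2
    | succ n ih =>
      rw [pow_succ', Module.End.mul_apply]
      exact fun h0 => ih (hinj (by rw [h0, map_zero]))
  have hli := Module.End.eigenvectors_linearIndependent' E (fun n : ℕ => μ * t⁻¹ ^ n)
    (fun a b hab => ht (by simpa [hμ] using hab)) _
    (fun n => ⟨Module.End.mem_eigenspace_iff.mpr (hΦ n), hnz n⟩)
  exact not_finite_iff_infinite.mpr inferInstance hli.finite

theorem exists_pow_ne_zero_and_eq_zero {E : End k V} (hE : IsNilpotent E) {v : V} (hv : v ≠ 0) :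
    ∃ n : ℕ, (E ^ n) v ≠ 0 ∧ E ((E ^ n) v) = 0 := by
  obtain ⟨N, hN⟩ := hE
  obtain ⟨n, h1, h2⟩ := Nat.exists_not_and_succ_of_not_zero_of_exists
    (p := fun n => (E ^ n) v = 0) (by simpa using hv) ⟨N, by simp [hN]⟩
  exact ⟨n, h1, by rwa [pow_succ', Module.End.mul_apply] at h2⟩

/-- Nakayama's lemma for a pair of commuting nilpotent operators. -/
theorem span_pow_mul_pow_eq_top {E₁ E₂ : End k V} (hc : Commute E₁ E₂) (h₁ : IsNilpotent E₁)
    (h₂ : IsNilpotent E₂) {w : V}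
    (hw : (k ∙ w) ⊔ (LinearMap.range E₁ ⊔ LinearMap.range E₂) = ⊤) :
    Submodule.span k (Set.range fun ij : ℕ × ℕ => (E₁ ^ ij.1) ((E₂ ^ ij.2) w)) = ⊤ := by
  obtain ⟨N₁, hN₁⟩ := h₁
  obtain ⟨N₂, hN₂⟩ := h₂
  set S := Submodule.span k (Set.range fun ij : ℕ × ℕ => (E₁ ^ ij.1) ((E₂ ^ ij.2) w)) with hS
  -- Descending induction on total degree: in degree `N₁ + N₂` every monomial operator vanishes, and
  -- below that an element of the range of `E₁` or `E₂` raises the degree by one.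
  have key : ∀ n, n ≤ N₁ + N₂ → ∀ i j, i + j = n → ∀ v, (E₁ ^ i) ((E₂ ^ j) v) ∈ S := by
    intro n hn
    induction hn using Nat.decreasingInduction with
    | self =>
      intro i j hij v
      rcases le_or_gt N₁ i with h | h
      · rw [pow_eq_zero_of_le h hN₁]; exact zero_mem _
      · rw [pow_eq_zero_of_le (show N₂ ≤ j by omega) hN₂]; simp
    | of_succ n _ ih =>
      intro i j hij v
      have hv : v ∈ (k ∙ w) ⊔ (LinearMap.range E₁ ⊔ LinearMap.range E₂) := hw ▸ Submodule.mem_top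
      obtain ⟨a, ha, u, hu, rfl⟩ := Submodule.mem_sup.mp hv
      obtain ⟨_, ⟨x, rfl⟩, _, ⟨y, rfl⟩, rfl⟩ := Submodule.mem_sup.mp hu
      obtain ⟨c, rfl⟩ := Submodule.mem_span_singleton.mp ha
      simp only [map_add, map_smul]
      refine add_mem (Submodule.smul_mem _ _ (Submodule.subset_span ⟨(i, j), rfl⟩)) (add_mem ?_ ?_)
      · have : (E₂ ^ j) (E₁ x) = E₁ ((E₂ ^ j) x) :=
          LinearMap.congr_fun (hc.pow_right j).symm.eq x
        rw [this, ← Module.End.mul_apply (E₁ ^ i), ← pow_succ]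
        exact ih (i + 1) j (by omega) x
      · rw [← Module.End.mul_apply (E₂ ^ j), ← pow_succ]
        exact ih i (j + 1) (by omega) y
  rw [eq_top_iff]
  intro v _
  simpa using key 0 (Nat.zero_le _) 0 0 rfl v

theorem apply_mem_maxGenEigenspace_of_rescaling {Φ E : End k V} {t μ : k}
    (h : ∀ v, Φ (E v) = t • E (Φ v)) {v : V} (hv : v ∈ Φ.maxGenEigenspace μ) :
    E v ∈ Φ.maxGenEigenspace (t * μ) := by
  rw [Module.End.mem_maxGenEigenspace] at hv ⊢
  obtain ⟨n, hn⟩ := hv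
  refine ⟨n, ?_⟩
  have : ∀ n : ℕ, ∀ v, ((Φ - (t * μ) • (1 : End k V)) ^ n) (E v) =
      t ^ n • E (((Φ - μ • (1 : End k V)) ^ n) v) := by
    intro n
    induction n with
    | zero => simp
    | succ n ih =>
      intro v
      rw [pow_succ, Module.End.mul_apply, pow_succ (Φ - μ • (1 : End k V)), Module.End.mul_apply]
      have : (Φ - (t * μ) • (1 : End k V)) (E v) = E (t • (Φ - μ • (1 : End k V)) v) := by
        simp [h, smul_sub, mul_smul]
      rw [this, ih, map_smul, map_smul, smul_smul, pow_succ]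
  rw [this, hn, map_zero, smul_zero]

/-- The operator `E₁ ^ i * E₂ ^ j` applied to a vector. -/
def bimonomial (E₁ E₂ : End k V) (w : V) (i j : ℕ) : V := (E₁ ^ i) ((E₂ ^ j) w)

theorem bimonomial_succ_left (E₁ E₂ : End k V) (w : V) (i j : ℕ) :
    bimonomial E₁ E₂ w (i + 1) j = E₁ (bimonomial E₁ E₂ w i j) := by
  rw [bimonomial, pow_succ', Module.End.mul_apply]; rfl

theorem bimonomial_succ_right {E₁ E₂ : End k V} (hc : Commute E₁ E₂) (w : V) (i j : ℕ) :
    bimonomial E₁ E₂ w i (j + 1) = E₂ (bimonomial E₁ E₂ w i j) := by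
  rw [bimonomial, pow_succ', Module.End.mul_apply]
  exact LinearMap.congr_fun (hc.pow_left i).eq _

theorem bimonomial_add {E₁ E₂ : End k V} (hc : Commute E₁ E₂) (w : V) (i j a b : ℕ) :
    (E₁ ^ a) ((E₂ ^ b) (bimonomial E₁ E₂ w i j)) = bimonomial E₁ E₂ w (a + i) (b + j) := by
  simp only [bimonomial, ← Module.End.mul_apply, pow_add]
  have : E₁ ^ i * E₂ ^ b = E₂ ^ b * E₁ ^ i := (hc.pow_pow i b).eq
  congr 1
  rw [mul_assoc (E₁ ^ a), ← mul_assoc (E₁ ^ i), this]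
  simp only [mul_assoc]

variable [CharZero k] [IsAlgClosed k] [FiniteDimensional k V]

/-- A pair of commuting operators which can be independently rescaled, whose socle and cosocle are
one-dimensional, has a rectangular monomial basis. -/
theorem exists_rectangular {E₁ E₂ : End k V} (hc : Commute E₁ E₂) (Φ : (End k V)ˣ)
    (h₁ : ∀ v, (Φ : End k V) (E₁ v) = (2 : k) • E₁ ((Φ : End k V) v))
    (h₂ : ∀ v, (Φ : End k V) (E₂ v) = (3 : k) • E₂ ((Φ : End k V) v))
    (hker : finrank k (LinearMap.ker E₁ ⊓ LinearMap.ker E₂ : Submodule k V) = 1)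
    (hran : finrank k (LinearMap.range E₁ ⊔ LinearMap.range E₂ : Submodule k V) + 1 =
      finrank k V) :
    ∃ (w : V) (c : k) (p q : ℕ), c ≠ 0 ∧
      (∀ i j, (Φ : End k V) (bimonomial E₁ E₂ w i j) =
        (c * (2 ^ i * 3 ^ j)) • bimonomial E₁ E₂ w i j) ∧
      (∀ i j, bimonomial E₁ E₂ w i j ≠ 0 ↔ i ≤ p ∧ j ≤ q) ∧
      Submodule.span k (Set.range fun ij : ℕ × ℕ => bimonomial E₁ E₂ w ij.1 ij.2) = ⊤ := by
  have hn₁ : IsNilpotent E₁ := isNilpotent_of_rescaling Φ two_ne_zero (fun a b hab =>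
    (cast_two_pow_mul_three_pow_injective (k := k) (j := 0) (j' := 0) (by simpa using hab)).1) h₁
  have hn₂ : IsNilpotent E₂ := isNilpotent_of_rescaling Φ three_ne_zero (fun a b hab =>
    (cast_two_pow_mul_three_pow_injective (k := k) (i := 0) (i' := 0) (by simpa using hab)).2) h₂
  set U : Submodule k V := LinearMap.range E₁ ⊔ LinearMap.range E₂ with hU
  -- The generalized eigenspaces of `Φ` span `V` and `U` is proper, so a generator modulo `U` can be
  -- chosen inside one of them.
  obtain ⟨c, hcU⟩ : ∃ c, ¬ (Φ : End k V).maxGenEigenspace c ≤ U := by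
    by_contra! hall
    have : U = ⊤ := by
      rw [eq_top_iff, ← Module.End.iSup_maxGenEigenspace_eq_top (Φ : End k V)]
      exact iSup_le hall
    rw [this, finrank_top] at hran
    omega
  obtain ⟨w, hwc, hwU⟩ := SetLike.not_le_iff_exists.mp hcU
  have hw0 : w ≠ 0 := fun h => hwU (h ▸ zero_mem _)
  have htop : (k ∙ w) ⊔ U = ⊤ := by
    refine Submodule.eq_top_of_finrank_eq (le_antisymm (Submodule.finrank_le _) ?_)
    have : U < (k ∙ w) ⊔ U := lt_of_le_of_ne le_sup_right fun h =>
      hwU (h ▸ Submodule.mem_sup_left (Submodule.mem_span_singleton_self w))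
    have := Submodule.finrank_lt_finrank_of_lt this
    omega
  have hspan := span_pow_mul_pow_eq_top hc hn₁ hn₂ htop
  set B := bimonomial E₁ E₂ w with hB
  change Submodule.span k (Set.range fun ij : ℕ × ℕ => B ij.1 ij.2) = ⊤ at hspan
  have hBsl : ∀ i j, B (i + 1) j = E₁ (B i j) := bimonomial_succ_left E₁ E₂ w
  have hBsr : ∀ i j, B i (j + 1) = E₂ (B i j) := bimonomial_succ_right hc w
  have hB00 : B 0 0 = w := rfl
  have hc0 : c ≠ 0 := by
    rintro rfl
    rw [Module.End.mem_maxGenEigenspace] at hwc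
    obtain ⟨n, hn⟩ := hwc
    rw [zero_smul, sub_zero] at hn
    refine hw0 ?_
    have := congrArg (((Φ ^ n)⁻¹ : (End k V)ˣ) : End k V) hn
    rw [← Module.End.mul_apply, ← Units.val_pow_eq_pow_val, Units.inv_mul] at this
    simpa using this
  have hBmem : ∀ i j, B i j ∈ (Φ : End k V).maxGenEigenspace (c * (2 ^ i * 3 ^ j)) := by
    intro i j
    induction i with
    | zero =>
      induction j with
      | zero => simpa [hB00] using hwc
      | succ j ih =>
        rw [hBsr, show c * (2 ^ 0 * 3 ^ (j + 1)) = 3 * (c * (2 ^ 0 * 3 ^ j)) by ring]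
        exact apply_mem_maxGenEigenspace_of_rescaling h₂ ih
    | succ i ih =>
      rw [hBsl, show c * (2 ^ (i + 1) * 3 ^ j) = 2 * (c * (2 ^ i * 3 ^ j)) by ring]
      exact apply_mem_maxGenEigenspace_of_rescaling h₁ ih
  have hUle : U ≤ ⨆ μ, ⨆ (_ : μ ≠ c), (Φ : End k V).maxGenEigenspace μ := by
    have hij : ∀ i j, (i ≠ 0 ∨ j ≠ 0) →
        B i j ∈ ⨆ μ, ⨆ (_ : μ ≠ c), (Φ : End k V).maxGenEigenspace μ := by
      intro i j hne
      refine Submodule.mem_iSup_of_mem (c * (2 ^ i * 3 ^ j)) (Submodule.mem_iSup_of_mem ?_ (hBmem i j))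
      intro h
      have h1 : (2 : k) ^ i * 3 ^ j = 2 ^ 0 * 3 ^ 0 := by
        rw [pow_zero, pow_zero, one_mul]; exact mul_left_cancel₀ hc0 (by rw [h, mul_one])
      have := cast_two_pow_mul_three_pow_injective h1
      omega
    rw [hU, LinearMap.range_eq_map, LinearMap.range_eq_map, ← hspan, Submodule.map_span,
      Submodule.map_span]
    refine sup_le (Submodule.span_le.mpr ?_) (Submodule.span_le.mpr ?_)
    · rintro _ ⟨_, ⟨⟨i, j⟩, rfl⟩, rfl⟩
      exact hBsl i j ▸ hij (i + 1) j (Or.inl (Nat.succ_ne_zero i))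
    · rintro _ ⟨_, ⟨⟨i, j⟩, rfl⟩, rfl⟩
      exact hBsr i j ▸ hij i (j + 1) (Or.inr (Nat.succ_ne_zero j))
  have hdisj := Module.End.independent_maxGenEigenspace (Φ : End k V) c
  -- `U` is spanned by monomials whose eigenvalues differ from `c`, so it meets this generalized
  -- eigenspace trivially. What remains is the line of `w`, which makes `w` a genuine eigenvector.
  have hline : (Φ : End k V).maxGenEigenspace c ≤ k ∙ w := by
    intro v hv
    have hv' : v ∈ (k ∙ w) ⊔ U := htop ▸ Submodule.mem_top
    obtain ⟨a, ha, u, hu, rfl⟩ := Submodule.mem_sup.mp hv'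
    have ha' : a ∈ (Φ : End k V).maxGenEigenspace c := by
      obtain ⟨r, rfl⟩ := Submodule.mem_span_singleton.mp ha
      exact Submodule.smul_mem _ _ hwc
    have hu' : u ∈ (Φ : End k V).maxGenEigenspace c := by
      simpa using sub_mem hv ha'
    have := Submodule.disjoint_def.mp hdisj u hu' (hUle hu)
    rwa [this, add_zero]
  have hΦw : (Φ : End k V) w = c • w := by
    have hmem : (Φ : End k V) w ∈ (Φ : End k V).maxGenEigenspace c :=
      Module.End.mapsTo_maxGenEigenspace_of_comm (Commute.refl (Φ : End k V)) c hwc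
    obtain ⟨a, ha⟩ := Submodule.mem_span_singleton.mp (hline hmem)
    rw [Module.End.mem_maxGenEigenspace] at hwc
    obtain ⟨n, hn⟩ := hwc
    have hpow : ∀ n : ℕ, (((Φ : End k V) - c • (1 : End k V)) ^ n) w = (a - c) ^ n • w := by
      intro n
      induction n with
      | zero => simp
      | succ n ih =>
        rw [pow_succ', Module.End.mul_apply, ih, map_smul, LinearMap.sub_apply, ← ha]
        simp only [LinearMap.smul_apply, Module.End.one_apply]
        rw [← sub_smul, smul_smul, pow_succ]
    rw [hpow, smul_eq_zero, or_iff_left hw0] at hn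
    rw [← ha, sub_eq_zero.mp (eq_zero_of_pow_eq_zero hn)]
  have hΦB : ∀ i j, (Φ : End k V) (B i j) = (c * (2 ^ i * 3 ^ j)) • B i j := by
    intro i j
    induction i with
    | zero =>
      induction j with
      | zero => simpa [hB00] using hΦw
      | succ j ih => rw [hBsr, h₂, ih, map_smul, smul_smul]; congr 1; ring
    | succ i ih => rw [hBsl, h₁, ih, map_smul, smul_smul]; congr 1; ring
  have hcorner : ∀ i j, B i j ≠ 0 → ∃ i' j', i ≤ i' ∧ j ≤ j' ∧ B i' j' ≠ 0 ∧
      E₁ (B i' j') = 0 ∧ E₂ (B i' j') = 0 := by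
    intro i j hij
    obtain ⟨a, ha, ha'⟩ := exists_pow_ne_zero_and_eq_zero hn₁ hij
    obtain ⟨b, hb, hb'⟩ := exists_pow_ne_zero_and_eq_zero hn₂ ha
    have hcc : ∀ v, E₁ ((E₂ ^ b) v) = (E₂ ^ b) (E₁ v) := fun v =>
      LinearMap.congr_fun (hc.pow_right b).eq v
    have e1 : (E₂ ^ b) ((E₁ ^ a) (B i j)) = B (a + i) (b + j) := by
      rw [hB, ← bimonomial_add hc]
      exact LinearMap.congr_fun (hc.pow_pow a b).symm.eq _
    rw [e1] at hb hb'
    refine ⟨a + i, b + j, by omega, by omega, hb, ?_, hb'⟩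
    rw [← e1, hcc, ha', map_zero]
  obtain ⟨p, q, -, -, hpq, hp1, hp2⟩ := hcorner 0 0 (by rwa [hB00])
  -- Two monomials in the socle are proportional, hence share a `Φ`-eigenvalue, hence share their
  -- exponents.
  have huniq : ∀ i j, B i j ≠ 0 → E₁ (B i j) = 0 → E₂ (B i j) = 0 → i = p ∧ j = q := by
    intro i j hij h1 h2
    obtain ⟨a, ha⟩ := (finrank_eq_one_iff_of_nonzero'
      (⟨B p q, hp1, hp2⟩ : (LinearMap.ker E₁ ⊓ LinearMap.ker E₂ : Submodule k V))
      (fun h => hpq (Subtype.ext_iff.mp h))).mp hker ⟨B i j, h1, h2⟩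
    have ha' : a • B p q = B i j := Subtype.ext_iff.mp ha
    have h3 := hΦB i j
    rw [← ha', map_smul, hΦB, ha', ← smul_assoc, smul_eq_mul, mul_comm a, mul_smul, ha',
      ← sub_eq_zero, ← sub_smul, smul_eq_zero, or_iff_left hij, sub_eq_zero] at h3
    have := cast_two_pow_mul_three_pow_injective (mul_left_cancel₀ hc0 h3)
    omega
  refine ⟨w, c, p, q, hc0, hΦB, fun i j => ⟨fun hij => ?_, fun ⟨hi, hj⟩ h0 => hpq ?_⟩, hspan⟩
  · obtain ⟨i', j', hi, hj, hne, h1, h2⟩ := hcorner i j hij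
    obtain ⟨rfl, rfl⟩ := huniq i' j' hne h1 h2
    exact ⟨hi, hj⟩
  · have := bimonomial_add hc w i j (p - i) (q - j)
    rw [Nat.sub_add_cancel hi, Nat.sub_add_cancel hj, ← hB, show B i j = 0 from h0, map_zero, map_zero] at this
    exact this.symm

end Bigraded

/-! ### Operators diagonal in a fixed basis. -/

section Diagonal
variable {k V ι : Type*} [Field k] [AddCommGroup V] [Module k V] [Fintype ι] [DecidableEq ι]
  (b : Basis ι k V)

theorem ad_linearMap_of_diagonal {D : End k V} {d : ι → k} (hD : ∀ a, D (b a) = d a • b a)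
    (ac : ι × ι) : LieAlgebra.ad k (End k V) D (b.linearMap b ac) =
      (d ac.1 - d ac.2) • b.linearMap b ac := by
  refine b.ext fun e => ?_
  simp only [LieAlgebra.ad_apply, Ring.lie_def, LinearMap.sub_apply, Module.End.mul_apply,
    LinearMap.smul_apply, hD, map_smul, Basis.linearMap_apply_apply]
  split_ifs with h
  · rw [hD, h]; module
  · simp

theorem conj_linearMap_of_diagonal (Φ : (End k V)ˣ) {ν : ι → k}
    (hΦ : ∀ a, (Φ : End k V) (b a) = ν a • b a) (hν : ∀ a, ν a ≠ 0) (ac : ι × ι) :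
    (Φ : End k V) * b.linearMap b ac * (Φ⁻¹ : (End k V)ˣ) =
      (ν ac.1 / ν ac.2) • b.linearMap b ac := by
  rw [Units.mul_inv_eq_iff_eq_mul]
  refine b.ext fun e => ?_
  simp only [Module.End.mul_apply, LinearMap.smul_apply, hΦ, map_smul,
    Basis.linearMap_apply_apply]
  split_ifs with h
  · rw [hΦ, h, smul_smul, mul_comm, div_mul_cancel₀ _ (hν e)]
  · simp

/-- Interpolation through finitely many compatible pairs of node and value. -/
theorem Polynomial.exists_eval_eq {α : Type*} [Finite α] (x y : α → k)
    (h : ∀ a c, x a = x c → y a = y c) : ∃ P : Polynomial k, ∀ a, P.eval (x a) = y a := by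
  classical
  have := Fintype.ofFinite α
  refine ⟨Lagrange.interpolate (Finset.univ.image x) id (Function.extend x y 0), fun a => ?_⟩
  have := Lagrange.eval_interpolate_at_node (Function.extend x y 0) (v := id)
    (s := Finset.univ.image x) (fun a _ c _ h => h)
    (Finset.mem_image_of_mem x (Finset.mem_univ a))
  rw [id] at this
  rw [this]
  exact Function.FactorsThrough.extend_apply (fun a c hac => h a c hac) _ _

/-- A subspace of operators stable under conjugation by a diagonal operator is stable under the
commutator with a diagonal operator whose weights are determined by those of the former. -/
theorem lie_mem_of_conj_mem (Φ : (End k V)ˣ) {ν d : ι → k}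
    (hΦ : ∀ a, (Φ : End k V) (b a) = ν a • b a) (hν : ∀ a, ν a ≠ 0)
    {D : End k V} (hD : ∀ a, D (b a) = d a • b a)
    (hνd : ∀ a c a' c', ν a / ν c = ν a' / ν c' → d a - d c = d a' - d c')
    {W : Submodule k (End k V)}
    (hW : ∀ X ∈ W, (Φ : End k V) * X * (Φ⁻¹ : (End k V)ˣ) ∈ W) :
    ∀ X ∈ W, ⁅D, X⁆ ∈ W := by
  -- The matrix units are common eigenvectors of conjugation by `Φ` and of `ad D`. By `hνd` the
  -- second eigenvalue is a function of the first, so interpolation makes `ad D` a polynomial in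
  -- conjugation by `Φ`.
  obtain ⟨P, hP⟩ := Polynomial.exists_eval_eq (fun ac : ι × ι => ν ac.1 / ν ac.2)
    (fun ac => d ac.1 - d ac.2) fun a c h => hνd _ _ _ _ h
  set C : End k (End k V) := LinearMap.mulLeft k (Φ : End k V) *
    LinearMap.mulRight k ((Φ⁻¹ : (End k V)ˣ) : End k V) with hC
  have hCa : ∀ X, C X = (Φ : End k V) * X * (Φ⁻¹ : (End k V)ˣ) := fun X => by
    simp [hC, mul_assoc]
  have heq : Polynomial.aeval C P = LieAlgebra.ad k (End k V) D := by
    refine (b.linearMap b).ext fun ac => ?_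
    have hev : C.HasEigenvector (ν ac.1 / ν ac.2) (b.linearMap b ac) :=
      ⟨Module.End.mem_eigenspace_iff.mpr (by
        rw [hCa, conj_linearMap_of_diagonal b Φ hΦ hν]), (b.linearMap b).ne_zero ac⟩
    rw [Module.End.aeval_apply_of_hasEigenvector hev, hP, ad_linearMap_of_diagonal b hD]
  intro X hX
  rw [← LieAlgebra.ad_apply (R := k), ← heq]
  clear heq hP
  induction P using Polynomial.induction_on' generalizing X with
  | add p q hp hq => rw [map_add, LinearMap.add_apply]; exact add_mem (hp X hX) (hq X hX)
  | monomial n a =>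
    rw [Polynomial.aeval_monomial, Module.End.mul_apply, Module.algebraMap_end_apply]
    refine W.smul_mem _ ?_
    induction n generalizing X with
    | zero => simpa using hX
    | succ n ih =>
      rw [pow_succ, Module.End.mul_apply]
      exact ih _ (by rw [hCa]; exact hW X hX)

/-- The product runs over a `Finset.image`, so each difference of weights occurs once. The
polynomial is thus separable, which is what semisimplicity needs. -/
theorem aeval_ad_eq_zero_of_diagonal {D : End k V} {d : ι → k} (hD : ∀ a, D (b a) = d a • b a)
    [DecidableEq k] :
    Polynomial.aeval (LieAlgebra.ad k (End k V) D)
      (∏ s ∈ Finset.univ.image (fun ac : ι × ι => d ac.1 - d ac.2),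
        (Polynomial.X - Polynomial.C s)) = 0 := by
  refine (b.linearMap b).ext fun ac => ?_
  have hev : (LieAlgebra.ad k (End k V) D).HasEigenvector (d ac.1 - d ac.2) (b.linearMap b ac) :=
    ⟨Module.End.mem_eigenspace_iff.mpr (ad_linearMap_of_diagonal b hD ac),
      (b.linearMap b).ne_zero ac⟩
  rw [Module.End.aeval_apply_of_hasEigenvector hev, Polynomial.eval_prod,
    Finset.prod_eq_zero (Finset.mem_image_of_mem _ (Finset.mem_univ ac)) (by simp)]
  simp

/-- An operator commuting with a diagonal operator with distinct weights is diagonal. -/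
theorem exists_eq_smul_of_commute_diagonal {D T : End k V} {d : ι → k}
    (hd : Function.Injective d) (hD : ∀ a, D (b a) = d a • b a) (hT : ∀ v, D (T v) = T (D v))
    (a : ι) : ∃ c : k, T (b a) = c • b a := by
  have hrepr : ∀ v e, b.repr (D v) e = d e * b.repr v e := by
    intro v e
    conv_lhs => rw [← b.sum_repr v]
    simp only [map_sum, map_smul, hD, Finsupp.finsetSum_apply, Finsupp.smul_apply,
      Basis.repr_self, Finsupp.single_apply, smul_eq_mul]
    rw [Finset.sum_eq_single e]
    · simp [mul_comm]
    · intro f _ hf; simp [hf]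
    · simp
  refine ⟨b.repr (T (b a)) a, b.ext_elem fun e => ?_⟩
  rw [map_smul, Basis.repr_self, Finsupp.smul_apply, Finsupp.single_apply]
  by_cases h : a = e
  · simp [h]
  · have h1 := hrepr (T (b a)) e
    rw [hT, hD, map_smul, map_smul, Finsupp.smul_apply, smul_eq_mul, ← sub_eq_zero, ← sub_mul,
      mul_eq_zero, sub_eq_zero] at h1
    rw [h1.resolve_left fun h2 => h (hd h2)]
    simp [h]

end Diagonal

/-! ### Pulling spectral information back along a faithful representation. -/

section Rep
variable {k g V ι : Type*} [Field k] [LieRing g] [LieAlgebra k g]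
  [AddCommGroup V] [Module k V] [LieRingModule g V] [LieModule k g V] [LieModule.IsFaithful k g V]
  [Fintype ι] [DecidableEq ι] (b : Basis ι k V)

include b in
theorem exists_annihilating_of_diagonal [DecidableEq k] {h : g} {d : ι → k}
    (hD : ∀ a, toEnd k g V h (b a) = d a • b a) :
    Polynomial.aeval (LieAlgebra.ad k g h)
      (∏ s ∈ Finset.univ.image (fun ac : ι × ι => d ac.1 - d ac.2),
        (Polynomial.X - Polynomial.C s)) = 0 := by
  have hint : ∀ (P : Polynomial k) (y : g), toEnd k g V (Polynomial.aeval (LieAlgebra.ad k g h) P y) =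
      Polynomial.aeval (LieAlgebra.ad k (End k V) (toEnd k g V h)) P (toEnd k g V y) := by
    intro P y
    induction P using Polynomial.induction_on' with
    | add p q hp hq => simp only [map_add, LinearMap.add_apply, hp, hq]
    | monomial n a =>
      simp only [Polynomial.aeval_monomial, Module.End.mul_apply, Module.algebraMap_end_apply,
        map_smul]
      congr 1
      induction n with
      | zero => simp
      | succ n ih =>
        rw [pow_succ', pow_succ', Module.End.mul_apply, Module.End.mul_apply, ← ih]
        simp
  refine LinearMap.ext fun y => LieModule.IsFaithful.injective_toEnd (R := k) (M := V) ?_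
  rw [hint, aeval_ad_eq_zero_of_diagonal b hD]
  simp

include b in
theorem isSemisimple_ad_of_diagonal [FiniteDimensional k g] {h : g} {d : ι → k}
    (hD : ∀ a, toEnd k g V h (b a) = d a • b a) : (LieAlgebra.ad k g h).IsSemisimple := by
  classical
  refine Module.End.isSemisimple_of_squarefree_aeval_eq_zero ?_
    (exists_annihilating_of_diagonal b hD)
  refine Polynomial.Separable.squarefree ?_
  exact Polynomial.separable_prod_X_sub_C_iff'.mpr fun x _ y _ h => h

include b in
theorem exists_eq_sub_of_hasEigenvalue {h : g} {d : ι → k}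
    (hD : ∀ a, toEnd k g V h (b a) = d a • b a) {μ : k}
    (hμ : (LieAlgebra.ad k g h).HasEigenvalue μ) : ∃ a c, μ = d a - d c := by
  classical
  obtain ⟨y, hy⟩ := hμ.exists_hasEigenvector
  have h1 := LinearMap.congr_fun (exists_annihilating_of_diagonal b hD) y
  rw [Module.End.aeval_apply_of_hasEigenvector hy, LinearMap.zero_apply, smul_eq_zero,
    or_iff_left hy.2, Polynomial.eval_prod, Finset.prod_eq_zero_iff] at h1
  obtain ⟨s, hs, hs'⟩ := h1
  obtain ⟨ac, -, rfl⟩ := Finset.mem_image.mp hs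
  exact ⟨ac.1, ac.2, by simpa [sub_eq_zero] using hs'⟩

/-- An operator normalizing the image of a faithful representation of a Lie algebra with
nondegenerate Killing form acts on it as an inner derivation. -/
theorem exists_toEnd_lie_eq [FiniteDimensional k g] [LieAlgebra.IsKilling k g] {D : End k V}
    (hD : ∀ y : g, ∃ z : g, ⁅D, toEnd k g V y⁆ = toEnd k g V z) :
    ∃ h : g, ∀ y : g, ⁅D, toEnd k g V y⁆ = ⁅toEnd k g V h, toEnd k g V y⁆ := by
  have hinj : Function.Injective (toEnd k g V) := LieModule.IsFaithful.injective_toEnd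
  choose δ hδ using hD
  let δ' : LieDerivation k g g :=
    { toFun := δ
      map_add' := fun x y => hinj (by rw [← hδ, map_add, map_add, lie_add, hδ, hδ])
      map_smul' := fun c x => hinj (by
        rw [← hδ, map_smul, lie_smul, hδ, RingHom.id_apply, map_smul])
      leibniz' := fun x y => hinj (by
        change toEnd k g V (δ ⁅x, y⁆) = toEnd k g V (⁅x, δ y⁆ - ⁅y, δ x⁆)
        rw [← hδ, LieHom.map_lie, leibniz_lie, hδ, hδ, map_sub, LieHom.map_lie, LieHom.map_lie,
          ← lie_skew (toEnd k g V y)]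
        abel) }
  obtain ⟨h, hh⟩ := LieDerivation.IsKilling.exists_eq_ad δ'
  refine ⟨h, fun y => ?_⟩
  have : δ y = ⁅h, y⁆ := by
    rw [← LieDerivation.ad_apply_apply (R := k), hh]
    rfl
  rw [hδ, this, LieHom.map_lie]

end Rep

/-! ### Rectangular vectors and the operators they carry. -/

/-- A cyclic vector of a commuting pair whose nonzero monomial translates form a rectangular
basis. -/
structure IsRectangularVector {k V : Type*} [Field k] [AddCommGroup V] [Module k V]
    (E₁ E₂ : End k V) (w : V) (p q : ℕ) : Prop where
  comm : Commute E₁ E₂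
  ne_zero_iff : ∀ i j, bimonomial E₁ E₂ w i j ≠ 0 ↔ i ≤ p ∧ j ≤ q
  span : Submodule.span k (Set.range fun ij : ℕ × ℕ => bimonomial E₁ E₂ w ij.1 ij.2) = ⊤
  linearIndependent : LinearIndependent k
    (fun ij : Fin (p + 1) × Fin (q + 1) => bimonomial E₁ E₂ w ij.1 ij.2)

namespace IsRectangularVector
variable {k V : Type*} [Field k] [AddCommGroup V] [Module k V] {E₁ E₂ : End k V} {w : V} {p q : ℕ}

theorem eq_zero (hw : IsRectangularVector E₁ E₂ w p q) {i j : ℕ} (h : ¬ (i ≤ p ∧ j ≤ q)) :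
    bimonomial E₁ E₂ w i j = 0 := by
  by_contra h0
  exact h ((hw.ne_zero_iff i j).mp h0)

/-- The rectangular monomial basis. -/
noncomputable def basis (hw : IsRectangularVector E₁ E₂ w p q) :
    Basis (Fin (p + 1) × Fin (q + 1)) k V :=
  Basis.mk hw.linearIndependent (by
    rw [← hw.span, Submodule.span_le]
    rintro _ ⟨⟨i, j⟩, rfl⟩
    by_cases h : i ≤ p ∧ j ≤ q
    · exact Submodule.subset_span ⟨(⟨i, by omega⟩, ⟨j, by omega⟩), rfl⟩
    · simp only [hw.eq_zero h]; exact zero_mem _)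

theorem basis_apply (hw : IsRectangularVector E₁ E₂ w p q) (a : Fin (p + 1) × Fin (q + 1)) :
    hw.basis a = bimonomial E₁ E₂ w a.1 a.2 := by
  simp [basis]

theorem ext (hw : IsRectangularVector E₁ E₂ w p q) {T T' : End k V}
    (h : ∀ i j, T (bimonomial E₁ E₂ w i j) = T' (bimonomial E₁ E₂ w i j)) : T = T' :=
  LinearMap.ext_on_range hw.span fun ij => h ij.1 ij.2

theorem exists_end (hw : IsRectangularVector E₁ E₂ w p q) (f : ℕ → ℕ → V)
    (hf : ∀ i j, ¬ (i ≤ p ∧ j ≤ q) → f i j = 0) :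
    ∃ T : End k V, ∀ i j, T (bimonomial E₁ E₂ w i j) = f i j := by
  refine ⟨hw.basis.constr k fun a => f a.1 a.2, fun i j => ?_⟩
  by_cases h : i ≤ p ∧ j ≤ q
  · have := hw.basis.constr_basis k (fun a => f a.1 a.2) (⟨i, by omega⟩, ⟨j, by omega⟩)
    rwa [basis_apply] at this
  · rw [hf i j h, hw.eq_zero h, map_zero]

/-- Weight and lowering operators completing `E₁` and `E₂` to commuting `sl₂`-triples. -/
theorem exists_operators [CharZero k] (hw : IsRectangularVector E₁ E₂ w p q) :
    ∃ H₁ H₂ F₁ F₂ : End k V,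
      (∀ i j, H₁ (bimonomial E₁ E₂ w i j) = ((i : k) - p / 2) • bimonomial E₁ E₂ w i j) ∧
      (∀ i j, H₂ (bimonomial E₁ E₂ w i j) = ((j : k) - q / 2) • bimonomial E₁ E₂ w i j) ∧
      IsSl2Operators E₁ H₁ F₁ ∧ IsSl2Operators E₂ H₂ F₂ ∧
      Commute H₁ H₂ ∧ Commute H₁ E₂ ∧ Commute H₁ F₂ ∧ Commute E₁ H₂ ∧ Commute E₁ F₂ ∧
      Commute F₁ H₂ ∧ Commute F₁ E₂ ∧ Commute F₁ F₂ := by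
  set B := bimonomial E₁ E₂ w with hB
  have hB0 : ∀ i j, ¬ (i ≤ p ∧ j ≤ q) → B i j = 0 := fun i j h => hw.eq_zero h
  have e₁ : ∀ i j, E₁ (B i j) = B (i + 1) j := fun i j => (bimonomial_succ_left E₁ E₂ w i j).symm
  have e₂ : ∀ i j, E₂ (B i j) = B i (j + 1) := fun i j =>
    (bimonomial_succ_right hw.comm w i j).symm
  obtain ⟨H₁, hH₁⟩ : ∃ T : End k V, ∀ i j, T (B i j) = ((i : k) - p / 2) • B i j := hw.exists_end _
    fun i j h => by rw [hB0 i j h, smul_zero]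
  obtain ⟨H₂, hH₂⟩ : ∃ T : End k V, ∀ i j, T (B i j) = ((j : k) - q / 2) • B i j := hw.exists_end _
    fun i j h => by rw [hB0 i j h, smul_zero]
  -- The coefficient satisfies `i(p + 1 - i) - (i + 1)(p - i) = 2i - p`, which is the relation `[E₁,
  -- F₁] = 2H₁`. Its zeros at `i = 0` and `i = p + 1` absorb the truncated subtraction and the edge
  -- of the rectangle.
  obtain ⟨F₁, hF₁⟩ : ∃ T : End k V, ∀ i j, T (B i j) = ((i : k) * (p + 1 - i)) • B (i - 1) j := hw.exists_end _
    fun i j h => by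
      by_cases hi : i = p + 1
      · rw [hi]; simp
      · rw [hB0 _ _ (by omega), smul_zero]
  obtain ⟨F₂, hF₂⟩ : ∃ T : End k V, ∀ i j, T (B i j) = ((j : k) * (q + 1 - j)) • B i (j - 1) := hw.exists_end _
    fun i j h => by
      by_cases hj : j = q + 1
      · rw [hj]; simp
      · rw [hB0 _ _ (by omega), smul_zero]
  have hxt : ∀ {T T' : End k V}, (∀ i j, T (B i j) = T' (B i j)) → T = T' := hw.ext
  refine ⟨H₁, H₂, F₁, F₂, hH₁, hH₂, ⟨?_, ?_, ?_⟩, ⟨?_, ?_, ?_⟩, ?_, ?_, ?_, ?_, ?_, ?_, ?_, ?_⟩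
  · refine LinearMap.congr_fun (f := H₁ * E₁) (g := E₁ * H₁ + E₁) (hxt fun i j => ?_)
    simp only [Module.End.mul_apply, LinearMap.add_apply, e₁, hH₁, map_smul]
    push_cast; module
  · refine LinearMap.congr_fun (f := H₁ * F₁) (g := F₁ * H₁ - F₁) (hxt fun i j => ?_)
    simp only [Module.End.mul_apply, LinearMap.sub_apply, hF₁, hH₁, map_smul]
    rcases i with _ | i
    · simp
    · simp only [Nat.add_sub_cancel]; push_cast; module
  · refine LinearMap.congr_fun (f := E₁ * F₁) (g := F₁ * E₁ + (2 : k) • H₁) (hxt fun i j => ?_)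
    simp only [Module.End.mul_apply, LinearMap.add_apply, LinearMap.smul_apply, hF₁, hH₁, e₁,
      map_smul, Nat.add_sub_cancel]
    rcases i with _ | i
    · simp only [Nat.cast_zero, zero_mul, zero_smul]; push_cast; module
    · simp only [Nat.add_sub_cancel]; push_cast; module
  · refine LinearMap.congr_fun (f := H₂ * E₂) (g := E₂ * H₂ + E₂) (hxt fun i j => ?_)
    simp only [Module.End.mul_apply, LinearMap.add_apply, e₂, hH₂, map_smul]
    push_cast; module
  · refine LinearMap.congr_fun (f := H₂ * F₂) (g := F₂ * H₂ - F₂) (hxt fun i j => ?_)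
    simp only [Module.End.mul_apply, LinearMap.sub_apply, hF₂, hH₂, map_smul]
    rcases j with _ | j
    · simp
    · simp only [Nat.add_sub_cancel]; push_cast; module
  · refine LinearMap.congr_fun (f := E₂ * F₂) (g := F₂ * E₂ + (2 : k) • H₂) (hxt fun i j => ?_)
    simp only [Module.End.mul_apply, LinearMap.add_apply, LinearMap.smul_apply, hF₂, hH₂, e₂,
      map_smul, Nat.add_sub_cancel]
    rcases j with _ | j
    · simp only [Nat.cast_zero, zero_mul, zero_smul]; push_cast; module
    · simp only [Nat.add_sub_cancel]; push_cast; module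
  all_goals
    refine hxt fun i j => ?_
    simp only [Module.End.mul_apply, hH₁, hH₂, hF₁, hF₂, e₁, e₂, map_smul]
    try exact smul_comm _ _ _

/-- An operator commuting with `E₁` and `E₂` is determined by its value on the cyclic vector `w`,
hence is a polynomial in them; so the commutant of the pair is commutative. -/
theorem commute_of_commute (hw : IsRectangularVector E₁ E₂ w p q) {Z Z' : End k V}
    (h₁ : Commute Z E₁) (h₂ : Commute Z E₂) (h₁' : Commute Z' E₁) (h₂' : Commute Z' E₂) :
    Commute Z Z' := by
  have hQ : ∀ v, ∃ Q : End k V, (∀ T : End k V, Commute T E₁ → Commute T E₂ → Commute T Q) ∧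
      Q w = v := by
    intro v
    have hv : v ∈ Submodule.span k
        (Set.range fun ij : ℕ × ℕ => bimonomial E₁ E₂ w ij.1 ij.2) := hw.span ▸ Submodule.mem_top
    induction hv using Submodule.span_induction with
    | mem v hv =>
      obtain ⟨⟨i, j⟩, rfl⟩ := hv
      exact ⟨E₁ ^ i * E₂ ^ j, fun T h h' => (h.pow_right i).mul_right (h'.pow_right j), rfl⟩
    | zero => exact ⟨0, fun T _ _ => Commute.zero_right T, rfl⟩
    | add a b _ _ ha hb =>
      obtain ⟨P, hP, rfl⟩ := ha
      obtain ⟨Q, hQ, rfl⟩ := hb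
      exact ⟨P + Q, fun T h h' => (hP T h h').add_right (hQ T h h'), rfl⟩
    | smul c a _ ha =>
      obtain ⟨P, hP, rfl⟩ := ha
      exact ⟨c • P, fun T h h' => (hP T h h').smul_right c, rfl⟩
  obtain ⟨Q, hQ, hQw⟩ := hQ (Z' w)
  have : Z' = Q := by
    have hmon : ∀ T : End k V, Commute T E₁ → Commute T E₂ → ∀ i j,
        T (bimonomial E₁ E₂ w i j) = bimonomial E₁ E₂ (T w) i j := fun T h h' i j =>
      LinearMap.congr_fun ((h.pow_right i).mul_right (h'.pow_right j)).eq w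
    refine hw.ext fun i j => ?_
    rw [hmon Z' h₁' h₂', hmon Q (hQ E₁ (Commute.refl _) hw.comm).symm
      (hQ E₂ hw.comm.symm (Commute.refl _)).symm, hQw]
  rw [this]
  exact hQ Z h₁ h₂

/-- The combination of the two weight operators that separates all weights. -/
theorem separating_injective [CharZero k] :
    Function.Injective fun a : Fin (p + 1) × Fin (q + 1) =>
      ((a.1 : ℕ) : k) - p / 2 + ((p : k) + 1) * (((a.2 : ℕ) : k) - q / 2) := by
  rintro ⟨i, j⟩ ⟨i', j'⟩ h
  -- Up to a constant the weight is `i + (p + 1) j`, an expansion in base `p + 1` whose lower digit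
  -- is `i ≤ p`.
  have h1 : ((i : ℕ) : k) + ((p : k) + 1) * (j : ℕ) = (i' : ℕ) + ((p : k) + 1) * (j' : ℕ) := by
    linear_combination h
  have h2 : (i : ℕ) + (p + 1) * (j : ℕ) = (i' : ℕ) + (p + 1) * (j' : ℕ) := by exact_mod_cast h1
  have hi := i.2
  have hi' := i'.2
  have h3 : (i : ℕ) = i' := by
    have := congrArg (· % (p + 1)) h2
    simpa [Nat.add_mul_mod_self_left, Nat.mod_eq_of_lt hi, Nat.mod_eq_of_lt hi'] using this
  have h4 : (j : ℕ) = j' := by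
    rw [h3] at h2
    exact Nat.eq_of_mul_eq_mul_left (Nat.succ_pos p) (Nat.add_left_cancel h2)
  exact Prod.ext (Fin.ext h3) (Fin.ext h4)

theorem exists_eq_smul [CharZero k] (hw : IsRectangularVector E₁ E₂ w p q) {H₁ H₂ T : End k V}
    (hH₁ : ∀ i j, H₁ (bimonomial E₁ E₂ w i j) = ((i : k) - p / 2) • bimonomial E₁ E₂ w i j)
    (hH₂ : ∀ i j, H₂ (bimonomial E₁ E₂ w i j) = ((j : k) - q / 2) • bimonomial E₁ E₂ w i j)
    (hT : Commute (H₁ + ((p : k) + 1) • H₂) T) (a : Fin (p + 1) × Fin (q + 1)) :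
    ∃ c : k, T (hw.basis a) = c • hw.basis a := by
  refine exists_eq_smul_of_commute_diagonal hw.basis separating_injective (fun a => ?_)
    (D := H₁ + ((p : k) + 1) • H₂) (fun v => LinearMap.congr_fun hT.eq v) a
  rw [basis_apply, LinearMap.add_apply, LinearMap.smul_apply, hH₁, hH₂]
  module

/-- Commuting with the weight operators makes `w` an eigenvector of `Z`. Commuting with `E₁` and
`E₂` spreads its eigenvalue over the cyclic module, so `Z` is a scalar, and trace zero kills it. -/
theorem eq_zero_of_commute [CharZero k] (hw : IsRectangularVector E₁ E₂ w p q)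
    {H₁ H₂ Z : End k V}
    (hH₁ : ∀ i j, H₁ (bimonomial E₁ E₂ w i j) = ((i : k) - p / 2) • bimonomial E₁ E₂ w i j)
    (hH₂ : ∀ i j, H₂ (bimonomial E₁ E₂ w i j) = ((j : k) - q / 2) • bimonomial E₁ E₂ w i j)
    (h₁ : Commute Z E₁) (h₂ : Commute Z E₂) (hZ₁ : Commute H₁ Z) (hZ₂ : Commute H₂ Z)
    (htr : LinearMap.trace k V Z = 0) : Z = 0 := by
  obtain ⟨c, hc⟩ := hw.exists_eq_smul hH₁ hH₂ (hZ₁.add_left (hZ₂.smul_left ((p : k) + 1))) (0, 0)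
  rw [basis_apply] at hc
  have hZ : Z = c • 1 := by
    refine hw.ext fun i j => ?_
    have : Z (bimonomial E₁ E₂ w i j) = (E₁ ^ i * E₂ ^ j) (Z w) :=
      LinearMap.congr_fun ((h₁.pow_right i).mul_right (h₂.pow_right j)).eq w
    rw [this, show Z w = c • w from hc, map_smul]
    rfl
  have := Module.Finite.of_basis hw.basis
  rw [hZ, map_smul, LinearMap.trace_one, smul_eq_mul, mul_eq_zero, Nat.cast_eq_zero] at htr
  have hcard : finrank k V ≠ 0 := by
    rw [finrank_eq_card_basis hw.basis]; simp
  rw [hZ, htr.resolve_right hcard, zero_smul]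

end IsRectangularVector

/-! ### Adjoint action of `sl₂`-triples. -/

/-- An `sl₂`-triple `e, 2h, f` in a Lie algebra acts on it through `sl₂`-operators. -/
theorem isSl2Operators_ad {k L : Type*} [Field k] [LieRing L] [LieAlgebra k L] {e h f : L}
    (he : ⁅h, e⁆ = e) (hf : ⁅h, f⁆ = -f) (hef : ⁅e, f⁆ = (2 : k) • h) :
    IsSl2Operators (LieAlgebra.ad k L e) (LieAlgebra.ad k L h) (LieAlgebra.ad k L f) where
  hE x := by simp only [LieAlgebra.ad_apply]; rw [leibniz_lie, he, add_comm]
  hF x := by simp only [LieAlgebra.ad_apply]; rw [leibniz_lie, hf, neg_lie]; abel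
  EF x := by simp only [LieAlgebra.ad_apply]; rw [leibniz_lie, hef, smul_lie, add_comm]

namespace IsSl2Operators
variable {k V : Type*} [Field k] [AddCommGroup V] [Module k V] {E h F : End k V}

theorem lie_hE (s : IsSl2Operators E h F) : ⁅h, E⁆ = E := LinearMap.ext fun v => by
  simp [Ring.lie_def, s.hE]

theorem lie_hF (s : IsSl2Operators E h F) : ⁅h, F⁆ = -F := LinearMap.ext fun v => by
  simp [Ring.lie_def, s.hF]

theorem lie_EF (s : IsSl2Operators E h F) : ⁅E, F⁆ = (2 : k) • h := LinearMap.ext fun v => by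
  simp [Ring.lie_def, s.EF]

theorem trace_eq_zero [CharZero k] (s : IsSl2Operators E h F) : LinearMap.trace k V h = 0 := by
  have := congrArg (LinearMap.trace k V) s.lie_EF
  rw [LinearMap.trace_lie, map_smul, eq_comm, smul_eq_zero] at this
  exact this.resolve_left two_ne_zero

end IsSl2Operators

/-! ### Self-duality: socle against cosocle. -/

section Cosocle
variable {k g V : Type*} [Field k] [LieRing g] [LieAlgebra k g]
  [AddCommGroup V] [Module k V] [FiniteDimensional k V] [LieRingModule g V] [LieModule k g V]

/-- For a self-dual module, the fixed space of a pair has the same dimension as the coinvariants. -/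
theorem finrank_range_sup_range_add_finrank_pairFixed
    (self_dual : Nonempty (V ≃ₗ⁅k,g⁆ Module.Dual k V)) (e₁ e₂ : g) :
    finrank k (LinearMap.range (toEnd k g V e₁) ⊔ LinearMap.range (toEnd k g V e₂) :
      Submodule k V) + finrank k (pairFixed k V e₁ e₂) = finrank k V := by
  obtain ⟨ψ⟩ := self_dual
  -- The functionals vanishing on both images are exactly the fixed vectors of the dual module,
  -- which `ψ` identifies with those of `V`.
  have hann : (LinearMap.range (toEnd k g V e₁) ⊔ LinearMap.range (toEnd k g V e₂) :
      Submodule k V).dualAnnihilator = (pairFixed k V e₁ e₂).map (ψ.toLinearEquiv : V →ₗ[k] Dual k V) := by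
    ext f
    rw [Submodule.dualAnnihilator_sup_eq, Submodule.mem_inf, Submodule.mem_map_equiv]
    have hrange : ∀ e : g, f ∈ (LinearMap.range (toEnd k g V e)).dualAnnihilator ↔
        ⁅e, f⁆ = 0 := fun e => by
      rw [Submodule.mem_dualAnnihilator]
      constructor
      · intro h
        ext v
        rw [Module.Dual.lie_apply, LinearMap.zero_apply]
        simpa using h _ ⟨v, rfl⟩
      · rintro h _ ⟨v, rfl⟩
        have := LinearMap.congr_fun h v
        rw [Module.Dual.lie_apply, LinearMap.zero_apply] at this
        simpa using this
    have hsymm : ∀ e : g, ⁅e, ψ.toLinearEquiv.symm f⁆ = 0 ↔ ⁅e, f⁆ = 0 := fun e => by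
      rw [← ψ.toLinearEquiv.map_eq_zero_iff]
      have : ψ.toLinearEquiv ⁅e, ψ.toLinearEquiv.symm f⁆ = ⁅e, ψ.toLinearEquiv (ψ.toLinearEquiv.symm f)⁆ :=
        ψ.toLieModuleHom.map_lie e _
      rw [this, LinearEquiv.apply_symm_apply]
    rw [hrange, hrange, ← hsymm, ← hsymm e₂]
    rfl
  have h := Subspace.finrank_add_finrank_dualAnnihilator_eq
    (LinearMap.range (toEnd k g V e₁) ⊔ LinearMap.range (toEnd k g V e₂) : Submodule k V)
  rwa [hann, LinearEquiv.finrank_map_eq] at h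

end Cosocle

/-! ### Lifting the weight and lowering operators to the Lie algebra. -/

section Lift
variable {k g V : Type*} [Field k] [LieRing g] [LieAlgebra k g]
  [FiniteDimensional k g] [LieAlgebra.IsKilling k g]
  [AddCommGroup V] [Module k V] [LieRingModule g V] [LieModule k g V]
  [LieModule.IsFaithful k g V]

/-- The weight operators of a rectangular vector come from the Lie algebra. -/
theorem exists_toEnd_eq_weight_operators [CharZero k] {e₁ e₂ : g} {w : V} {p q : ℕ}
    (hw : IsRectangularVector (toEnd k g V e₁) (toEnd k g V e₂) w p q)
    {H₁ H₂ F₁ F₂ : End k V}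
    (hH₁ : ∀ i j, H₁ (bimonomial (toEnd k g V e₁) (toEnd k g V e₂) w i j) =
      ((i : k) - p / 2) • bimonomial (toEnd k g V e₁) (toEnd k g V e₂) w i j)
    (hH₂ : ∀ i j, H₂ (bimonomial (toEnd k g V e₁) (toEnd k g V e₂) w i j) =
      ((j : k) - q / 2) • bimonomial (toEnd k g V e₁) (toEnd k g V e₂) w i j)
    (s₁ : IsSl2Operators (toEnd k g V e₁) H₁ F₁) (s₂ : IsSl2Operators (toEnd k g V e₂) H₂ F₂)
    (hn₁ : ∀ y : g, ∃ z : g, ⁅H₁, toEnd k g V y⁆ = toEnd k g V z)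
    (hn₂ : ∀ y : g, ∃ z : g, ⁅H₂, toEnd k g V y⁆ = toEnd k g V z) :
    ∃ h₁ h₂ : g, toEnd k g V h₁ = H₁ ∧ toEnd k g V h₂ = H₂ := by
  obtain ⟨h₁, hh₁⟩ := exists_toEnd_lie_eq hn₁
  obtain ⟨h₂, hh₂⟩ := exists_toEnd_lie_eq hn₂
  have hcomm : ∀ {H : End k V} {h : g}, (∀ y, ⁅H, toEnd k g V y⁆ = ⁅toEnd k g V h, toEnd k g V y⁆) →
      ∀ y, Commute (H - toEnd k g V h) (toEnd k g V y) := fun hh y => by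
    rw [commute_iff_lie_eq, sub_lie, hh, sub_self]
  have c₁ := hcomm hh₁
  have c₂ := hcomm hh₂
  have c₁₂ := hw.commute_of_commute (c₁ e₁) (c₁ e₂) (c₂ e₁) (c₂ e₂)
  -- The differences `Zᵢ = Hᵢ - hᵢ` centralize the image of `g` and, lying in the commutant of the
  -- pair, commute with each other. Writing `Hⱼ = Zⱼ + hⱼ`, each `Hⱼ` commutes with each `Zᵢ`.
  have k₁₁ : Commute H₁ (H₁ - toEnd k g V h₁) := by
    have := (Commute.refl (H₁ - toEnd k g V h₁)).add_right (c₁ h₁)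
    rw [sub_add_cancel] at this
    exact this.symm
  have k₂₂ : Commute H₂ (H₂ - toEnd k g V h₂) := by
    have := (Commute.refl (H₂ - toEnd k g V h₂)).add_right (c₂ h₂)
    rw [sub_add_cancel] at this
    exact this.symm
  have k₂₁ : Commute H₂ (H₁ - toEnd k g V h₁) := by
    have := c₁₂.add_right (c₁ h₂)
    rw [sub_add_cancel] at this
    exact this.symm
  have k₁₂ : Commute H₁ (H₂ - toEnd k g V h₂) := by
    have := c₁₂.symm.add_right (c₂ h₁)
    rw [sub_add_cancel] at this
    exact this.symm
  refine ⟨h₁, h₂, ?_, ?_⟩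
  · refine (sub_eq_zero.mp (hw.eq_zero_of_commute hH₁ hH₂ (c₁ e₁) (c₁ e₂) k₁₁ k₂₁ ?_)).symm
    rw [map_sub, s₁.trace_eq_zero, trace_toEnd_eq_zero_of_isKilling, sub_zero]
  · refine (sub_eq_zero.mp (hw.eq_zero_of_commute hH₁ hH₂ (c₂ e₁) (c₂ e₂) k₁₂ k₂₂ ?_)).symm
    rw [map_sub, s₂.trace_eq_zero, trace_toEnd_eq_zero_of_isKilling, sub_zero]

/-- The eigenspaces of `ad h` for opposite eigenvalues have the same dimension. -/
theorem finrank_eigenspace_ad_le {h : g} (htop : ⨆ ν, (LieAlgebra.ad k g h).eigenspace ν = ⊤)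
    (μ : k) : finrank k ((LieAlgebra.ad k g h).eigenspace μ) ≤
      finrank k ((LieAlgebra.ad k g h).eigenspace (-μ)) := by
  set A := LieAlgebra.ad k g h
  -- Invariance makes the `μ`-eigenspace orthogonal to every eigenspace except that of `-μ`, so
  -- nondegeneracy embeds it in the dual of the latter.
  let f : A.eigenspace μ →ₗ[k] Dual k (A.eigenspace (-μ)) :=
    (Submodule.dualRestrict (A.eigenspace (-μ))) ∘ₗ (killingForm k g) ∘ₗ (A.eigenspace μ).subtype
  have hinj : Function.Injective f := by
    rw [← LinearMap.ker_eq_bot, LinearMap.ker_eq_bot']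
    rintro ⟨x, hx⟩ h0
    have hx' : ⁅h, x⁆ = μ • x := Module.End.mem_eigenspace_iff.mp hx
    refine Subtype.ext (LinearMap.ker_eq_bot'.mp
      (LieAlgebra.IsKilling.ker_killingForm_eq_bot k g) x (LinearMap.ext fun y => ?_))
    rw [LinearMap.zero_apply]
    have hy : y ∈ ⨆ ν, A.eigenspace ν := htop ▸ Submodule.mem_top
    induction hy using Submodule.iSup_induction' with
    | mem ν y hy =>
      by_cases hν : ν = -μ
      · subst hν
        exact LinearMap.congr_fun h0 ⟨y, hy⟩
      · have hy' : ⁅h, y⁆ = ν • y := Module.End.mem_eigenspace_iff.mp hy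
        have h1 := LieModule.traceForm_apply_lie_apply' k g g h x y
        rw [hx', hy', map_smul, LinearMap.smul_apply, map_smul, eq_neg_iff_add_eq_zero,
          ← add_smul, smul_eq_zero] at h1
        exact h1.resolve_left fun h2 => hν (by linear_combination h2)
    | zero => simp
    | add a b _ _ ha hb => rw [map_add, ha, hb, add_zero]
  exact (LinearMap.finrank_le_finrank_of_injective hinj).trans_eq Subspace.dual_finrank_eq

/-- The lowering operator of an `sl₂`-triple whose other members come from the Lie algebra also
comes from the Lie algebra. -/
theorem exists_toEnd_eq_lowering [CharZero k] [FiniteDimensional k V] {e h : g} {F : End k V}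
    (s : IsSl2Operators (toEnd k g V e) (toEnd k g V h) F)
    (htop : ⨆ ν, (LieAlgebra.ad k g h).eigenspace ν = ⊤) : ∃ f : g, toEnd k g V f = F := by
  have hinj : Function.Injective (toEnd k g V) := LieModule.IsFaithful.injective_toEnd
  have S := isSl2Operators_ad (k := k) s.lie_hE s.lie_hF s.lie_EF
  have hhe : ⁅h, e⁆ = e := hinj (by rw [LieHom.map_lie, s.lie_hE])
  have hzero : ∀ X : End k V, ⁅toEnd k g V h, X⁆ = -X →
      ⁅toEnd k g V e, ⁅toEnd k g V e, X⁆⁆ = 0 → X = 0 := fun X h1 h2 =>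
    S.eq_zero_of_weight_neg_one h1 h2
  set A := LieAlgebra.ad k g h with hA
  -- The operator `F` has weight `-1` and satisfies `[e, [e, F]] = -2e`, and these two conditions
  -- determine it. So it suffices to solve them in `g`, where `(ad e)²` from weight `-1` to weight
  -- `1` is bijective by injectivity and equality of dimensions.
  have hmap : ∀ x ∈ A.eigenspace (-1),
      (LieAlgebra.ad k g e * LieAlgebra.ad k g e) x ∈ A.eigenspace 1 := fun x hx => by
    rw [Module.End.mem_eigenspace_iff] at hx ⊢
    simp only [hA, Module.End.mul_apply, LieAlgebra.ad_apply] at hx ⊢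
    rw [leibniz_lie h e, leibniz_lie h e, hhe, hx, lie_smul, lie_add, lie_smul]
    module
  let T : A.eigenspace (-1) →ₗ[k] A.eigenspace 1 :=
    (LieAlgebra.ad k g e * LieAlgebra.ad k g e).restrict hmap
  have hT : Function.Injective T := by
    rw [← LinearMap.ker_eq_bot, LinearMap.ker_eq_bot']
    rintro ⟨x, hx⟩ h0
    have h0' : ⁅e, ⁅e, x⁆⁆ = 0 := Subtype.ext_iff.mp h0
    have hx' : ⁅h, x⁆ = (-1 : k) • x := Module.End.mem_eigenspace_iff.mp hx
    refine Subtype.ext (hinj ?_)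
    rw [ZeroMemClass.coe_zero, map_zero]
    refine hzero _ ?_ ?_
    · rw [← LieHom.map_lie, hx', map_smul, neg_one_smul]
    · rw [← LieHom.map_lie, ← LieHom.map_lie, h0', map_zero]
  have hdim : finrank k (A.eigenspace (-1)) = finrank k (A.eigenspace 1) :=
    le_antisymm (LinearMap.finrank_le_finrank_of_injective hT) (finrank_eigenspace_ad_le htop 1)
  obtain ⟨⟨f, hf⟩, hf'⟩ := (LinearMap.injective_iff_surjective_of_finrank_eq_finrank hdim).mp hT
    ⟨-(2 : k) • e, Module.End.mem_eigenspace_iff.mpr (by simp [hA, hhe])⟩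
  have h1 : ⁅h, f⁆ = (-1 : k) • f := Module.End.mem_eigenspace_iff.mp hf
  have h2 : ⁅e, ⁅e, f⁆⁆ = -(2 : k) • e := Subtype.ext_iff.mp hf'
  refine ⟨f, sub_eq_zero.mp (hzero _ ?_ ?_)⟩
  · rw [lie_sub, ← LieHom.map_lie, h1, s.lie_hF, map_smul, neg_one_smul]; abel
  · rw [lie_sub, lie_sub, ← LieHom.map_lie, ← LieHom.map_lie, h2, s.lie_EF, lie_smul, ← lie_skew,
      s.lie_hE, map_smul]
    module

end Lift

/-! ### Assembling rectangularity and principality. -/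

theorem lie_mem_ker_ad {k g : Type*} [Field k] [LieRing g] [LieAlgebra k g] {a e : g}
    (h : ⁅a, e⁆ = 0) : ∀ x ∈ LinearMap.ker (LieAlgebra.ad k g e),
      LieAlgebra.ad k g a x ∈ LinearMap.ker (LieAlgebra.ad k g e) := fun x hx => by
  rw [LinearMap.mem_ker, LieAlgebra.ad_apply] at hx ⊢
  rw [LieAlgebra.ad_apply, leibniz_lie, hx, ← lie_skew e a, h, neg_zero, zero_lie, lie_zero, add_zero]

theorem Module.End.iSup_eigenspace_eq_top_of_isSemisimple {k V : Type*} [Field k] [IsAlgClosed k]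
    [AddCommGroup V] [Module k V] [FiniteDimensional k V] {f : End k V} (hf : f.IsSemisimple) :
    ⨆ μ, f.eigenspace μ = ⊤ := by
  simp_rw [← hf.isFinitelySemisimple.maxGenEigenspace_eq_eigenspace]
  exact Module.End.iSup_maxGenEigenspace_eq_top _

/-- A nilpotent pair with one-dimensional fixed space in a self-dual module acts through a
rectangular vector, which is an eigenvector basis for an operator implementing a rescaling. -/
theorem IsNilpotentPair.exists_isRectangularVector {k g V : Type*} [Field k] [IsAlgClosed k]
    [CharZero k] [LieRing g] [LieAlgebra k g] [FiniteDimensional k g] [LieAlgebra.IsKilling k g]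
    [AddCommGroup V] [Module k V] [FiniteDimensional k V] [LieRingModule g V] [LieModule k g V]
    (self_dual : Nonempty (V ≃ₗ⁅k,g⁆ Module.Dual k V))
    {e₁ e₂ : g} (he : IsNilpotentPair k e₁ e₂)
    (hfixed : finrank k (pairFixed k V e₁ e₂) = 1) :
    ∃ (w : V) (p q : ℕ) (Φ : (End k V)ˣ) (c : k), c ≠ 0 ∧
      IsRectangularVector (toEnd k g V e₁) (toEnd k g V e₂) w p q ∧
      (∀ y : g, ∃ z : g, (Φ : End k V) * toEnd k g V y * (Φ⁻¹ : (End k V)ˣ) = toEnd k g V z) ∧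
      ∀ i j, (Φ : End k V) (bimonomial (toEnd k g V e₁) (toEnd k g V e₂) w i j) =
        (c * (2 ^ i * 3 ^ j)) • bimonomial (toEnd k g V e₁) (toEnd k g V e₂) w i j := by
  obtain ⟨φ, hφ, hφ₁, hφ₂⟩ := he.rescale 2 3 two_ne_zero three_ne_zero
  obtain ⟨Φ, hΦ⟩ := exists_conj_of_mem_adjointGroup (V := V) hφ
  have hresc : ∀ {e : g} {t : k}, φ e = t • e → ∀ v, (Φ : End k V) (toEnd k g V e v) =
      t • toEnd k g V e ((Φ : End k V) v) := fun {e t} h v => by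
    have h1 := hΦ e
    rw [h, map_smul, Units.eq_mul_inv_iff_mul_eq] at h1
    exact (LinearMap.congr_fun h1 v).symm
  have hc : Commute (toEnd k g V e₁) (toEnd k g V e₂) := by
    rw [commute_iff_lie_eq, ← LieHom.map_lie, he.comm, map_zero]
  have hran := finrank_range_sup_range_add_finrank_pairFixed self_dual e₁ e₂
  rw [hfixed] at hran
  obtain ⟨w, c, p, q, hc0, hΦB, hne, hspan⟩ :=
    exists_rectangular hc Φ (hresc hφ₁) (hresc hφ₂) hfixed hran
  refine ⟨w, p, q, Φ, c, hc0, ⟨hc, hne, hspan, ?_⟩, fun y => ⟨φ y, (hΦ y).symm⟩, hΦB⟩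
  refine Module.End.eigenvectors_linearIndependent' (Φ : End k V)
    (fun ij : Fin (p + 1) × Fin (q + 1) => c * (2 ^ (ij.1 : ℕ) * 3 ^ (ij.2 : ℕ))) ?_ _
    (fun ij => ⟨Module.End.mem_eigenspace_iff.mpr (hΦB _ _), (hne _ _).mpr ⟨by omega, by omega⟩⟩)
  intro a b hab
  have := cast_two_pow_mul_three_pow_injective (mul_left_cancel₀ hc0 hab)
  exact Prod.ext (Fin.ext this.1) (Fin.ext this.2)

/-- A nilpotent pair with one-dimensional fixed space in a faithful self-dual module is rectangular
and principal. -/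
theorem IsNilpotentPair.isRectangularPair_and_isPrincipalPair {k g V : Type*} [Field k] [IsAlgClosed k] [CharZero k]
    [LieRing g] [LieAlgebra k g] [FiniteDimensional k g] [LieAlgebra.IsSemisimple k g]
    [AddCommGroup V] [Module k V] [FiniteDimensional k V]
    [LieRingModule g V] [LieModule k g V] [LieModule.IsFaithful k g V]
    (self_dual : Nonempty (V ≃ₗ⁅k,g⁆ Module.Dual k V))
    {e₁ e₂ : g} (he : IsNilpotentPair k e₁ e₂)
    (hfixed : Module.finrank k (pairFixed k V e₁ e₂) = 1) :
    IsRectangularPair k e₁ e₂ ∧ IsPrincipalPair k e₁ e₂ := by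
  have hinj : Function.Injective (toEnd k g V) := LieModule.IsFaithful.injective_toEnd
  obtain ⟨w, p, q, Φ, c, hc0, hw, hΦ, hΦB⟩ := he.exists_isRectangularVector self_dual hfixed
  obtain ⟨H₁, H₂, F₁, F₂, hH₁, hH₂, s₁, s₂, cHH, cHE, cHF, cEH, cEF, cFH, cFE, cFF⟩ :=
    hw.exists_operators
  have hΦb : ∀ a, (Φ : End k V) (hw.basis a) =
      (c * (2 ^ (a.1 : ℕ) * 3 ^ (a.2 : ℕ))) • hw.basis a := fun a => by
    rw [hw.basis_apply, hΦB]
  have hH₁b : ∀ a, H₁ (hw.basis a) = (((a.1 : ℕ) : k) - p / 2) • hw.basis a := fun a => by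
    rw [hw.basis_apply, hH₁]
  have hH₂b : ∀ a, H₂ (hw.basis a) = (((a.2 : ℕ) : k) - q / 2) • hw.basis a := fun a => by
    rw [hw.basis_apply, hH₂]
  have hν : ∀ a : Fin (p + 1) × Fin (q + 1), c * (2 ^ (a.1 : ℕ) * 3 ^ (a.2 : ℕ)) ≠ 0 := fun a =>
    mul_ne_zero hc0 (mul_ne_zero (pow_ne_zero _ two_ne_zero) (pow_ne_zero _ three_ne_zero))
  -- Ratios of `Φ`-eigenvalues determine differences of exponents. These are stated additively to
  -- avoid subtraction in `ℕ`.
  have hdiff : ∀ a b a' b' : Fin (p + 1) × Fin (q + 1),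
      c * (2 ^ (a.1 : ℕ) * 3 ^ (a.2 : ℕ)) / (c * (2 ^ (b.1 : ℕ) * 3 ^ (b.2 : ℕ))) =
        c * (2 ^ (a'.1 : ℕ) * 3 ^ (a'.2 : ℕ)) / (c * (2 ^ (b'.1 : ℕ) * 3 ^ (b'.2 : ℕ))) →
      (a.1 : ℕ) + b'.1 = a'.1 + b.1 ∧ (a.2 : ℕ) + b'.2 = a'.2 + b.2 := by
    intro a b a' b' h
    rw [div_eq_div_iff (hν b) (hν b')] at h
    refine cast_two_pow_mul_three_pow_injective (k := k) (mul_left_cancel₀ (mul_ne_zero hc0 hc0) ?_)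
    rw [pow_add, pow_add, pow_add, pow_add]
    linear_combination h
  have hW : ∀ X ∈ LinearMap.range (toEnd k g V : g →ₗ[k] End k V),
      (Φ : End k V) * X * (Φ⁻¹ : (End k V)ˣ) ∈
        LinearMap.range (toEnd k g V : g →ₗ[k] End k V) := by
    rintro _ ⟨y, rfl⟩
    obtain ⟨z, hz⟩ := hΦ y
    exact ⟨z, hz.symm⟩
  have hn₁ : ∀ y : g, ∃ z : g, ⁅H₁, toEnd k g V y⁆ = toEnd k g V z := fun y => by
    obtain ⟨z, hz⟩ := lie_mem_of_conj_mem hw.basis Φ hΦb hν hH₁b (fun a b a' b' h => by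
      have h1 : ((a.1 : ℕ) : k) + (b'.1 : ℕ) = (a'.1 : ℕ) + (b.1 : ℕ) := by
        exact_mod_cast (hdiff a b a' b' h).1
      linear_combination h1) hW _ ⟨y, rfl⟩
    exact ⟨z, hz.symm⟩
  have hn₂ : ∀ y : g, ∃ z : g, ⁅H₂, toEnd k g V y⁆ = toEnd k g V z := fun y => by
    obtain ⟨z, hz⟩ := lie_mem_of_conj_mem hw.basis Φ hΦb hν hH₂b (fun a b a' b' h => by
      have h1 : ((a.2 : ℕ) : k) + (b'.2 : ℕ) = (a'.2 : ℕ) + (b.2 : ℕ) := by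
        exact_mod_cast (hdiff a b a' b' h).2
      linear_combination h1) hW _ ⟨y, rfl⟩
    exact ⟨z, hz.symm⟩
  obtain ⟨h₁, h₂, rfl, rfl⟩ := exists_toEnd_eq_weight_operators hw hH₁ hH₂ s₁ s₂ hn₁ hn₂
  have ss₁ := isSemisimple_ad_of_diagonal hw.basis hH₁b
  have ss₂ := isSemisimple_ad_of_diagonal hw.basis hH₂b
  have top₁ := Module.End.iSup_eigenspace_eq_top_of_isSemisimple ss₁
  have top₂ := Module.End.iSup_eigenspace_eq_top_of_isSemisimple ss₂
  obtain ⟨f₁, rfl⟩ := exists_toEnd_eq_lowering s₁ top₁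
  obtain ⟨f₂, rfl⟩ := exists_toEnd_eq_lowering s₂ top₂
  have hlie : ∀ {a b : g}, Commute (toEnd k g V a) (toEnd k g V b) → ⁅a, b⁆ = 0 := fun h =>
    hinj (by rw [LieHom.map_lie, map_zero]; exact commute_iff_lie_eq.mp h)
  have h₁e₁ : ⁅h₁, e₁⁆ = e₁ := hinj (by rw [LieHom.map_lie, s₁.lie_hE])
  have h₂e₂ : ⁅h₂, e₂⁆ = e₂ := hinj (by rw [LieHom.map_lie, s₂.lie_hE])
  have h₁f₁ : ⁅h₁, f₁⁆ = -f₁ := hinj (by rw [LieHom.map_lie, s₁.lie_hF, map_neg])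
  have h₂f₂ : ⁅h₂, f₂⁆ = -f₂ := hinj (by rw [LieHom.map_lie, s₂.lie_hF, map_neg])
  have e₁f₁ : ⁅e₁, f₁⁆ = (2 : k) • h₁ := hinj (by rw [LieHom.map_lie, s₁.lie_EF, map_smul])
  have e₂f₂ : ⁅e₂, f₂⁆ = (2 : k) • h₂ := hinj (by rw [LieHom.map_lie, s₂.lie_EF, map_smul])
  have hh := hlie cHH
  have h₁e₂ := hlie cHE
  have h₁f₂ := hlie cHF
  have e₁h₂ := hlie cEH
  have e₁f₂ := hlie cEF
  have f₁h₂ := hlie cFH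
  have f₁e₂ := hlie cFE
  have f₁f₂ := hlie cFF
  have hsymm : ∀ {a b : g}, ⁅a, b⁆ = 0 → ⁅b, a⁆ = 0 := fun h => by rw [← lie_skew, h, neg_zero]
  have hnsmul : ∀ x : g, (2 : k) • x = (2 : ℕ) • x := fun x => by
    rw [two_smul, two_smul]
  -- By invariance `2κ(h, z) = κ([e, f], z) = -κ(f, [e, z]) = 0`.
  have horth : ∀ {e h f z : g}, ⁅e, f⁆ = (2 : k) • h → ⁅e, z⁆ = 0 → killingForm k g h z = 0 := by
    intro e h f z hef hez
    have h1 := LieModule.traceForm_apply_lie_apply' k g g e f z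
    rw [hef, hez, map_zero, neg_zero, map_smul, LinearMap.smul_apply, smul_eq_zero] at h1
    exact h1.resolve_left two_ne_zero
  have hchar : IsCharacteristic k e₁ e₂ h₁ h₂ :=
    { semisimple₁ := ss₁, semisimple₂ := ss₂, comm := hh, lie₁₁ := h₁e₁, lie₁₂ := h₁e₂,
      lie₂₁ := hsymm e₁h₂, lie₂₂ := h₂e₂
      orth₁ := fun z hz => horth e₁f₁ hz.1
      orth₂ := fun z hz => horth e₂f₂ hz.2 }
  have hrel : ∀ {e h f : g}, ⁅h, e⁆ = e → ⁅h, f⁆ = -f → ⁅e, f⁆ = (2 : k) • h →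
      Sl2Relations e ((2 : ℕ) • h) f := fun {e h f} he hf hef =>
    { lie_h_e := by rw [nsmul_lie, he]
      lie_h_f := by rw [nsmul_lie, hf, smul_neg]
      lie_e_f := by rw [hef, hnsmul] }
  refine ⟨⟨he, h₁, h₂, f₁, f₂, hchar, hrel h₁e₁ h₁f₁ e₁f₁, hrel h₂e₂ h₂f₂ e₂f₂, ?_⟩, ⟨he, ?_⟩⟩
  · rintro x (rfl | rfl | rfl) y (rfl | rfl | rfl) <;>
      simp only [nsmul_lie, lie_nsmul, he.comm, e₁h₂, e₁f₂, h₁e₂, hh, h₁f₂, f₁e₂, f₁h₂, f₁f₂,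
        smul_zero]
  · have S₁ := isSl2Operators_ad (k := k) h₁e₁ h₁f₁ e₁f₁
    have S₂ := isSl2Operators_ad (k := k) h₂e₂ h₂f₂ e₂f₂
    -- The weights on `V` may be half-integral, but the half-integral shift cancels in the
    -- differences that occur on `g`.
    have int₁ : ∀ μ, (LieAlgebra.ad k g h₁).HasEigenvalue μ → ∃ n : ℤ, μ = n := fun μ hμ => by
      obtain ⟨a, b, rfl⟩ := exists_eq_sub_of_hasEigenvalue hw.basis hH₁b hμ
      exact ⟨(a.1 : ℕ) - (b.1 : ℕ), by push_cast; ring⟩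
    have int₂ : ∀ μ, (LieAlgebra.ad k g h₂).HasEigenvalue μ → ∃ n : ℤ, μ = n := fun μ hμ => by
      obtain ⟨a, b, rfl⟩ := exists_eq_sub_of_hasEigenvalue hw.basis hH₂b hμ
      exact ⟨(a.2 : ℕ) - (b.2 : ℕ), by push_cast; ring⟩
    have hdiag : ∀ y : g, ⁅h₁ + ((p : k) + 1) • h₂, y⁆ = 0 → ∀ a, ∃ t : k,
        toEnd k g V y (hw.basis a) = t • hw.basis a := fun y hy =>
      hw.exists_eq_smul hH₁ hH₂ (by
        rw [commute_iff_lie_eq, ← map_smul, ← map_add, ← LieHom.map_lie, hy, map_zero])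
    have hcomm : ∀ y z : g, (∀ a, ∃ t : k, toEnd k g V y (hw.basis a) = t • hw.basis a) →
        (∀ a, ∃ t : k, toEnd k g V z (hw.basis a) = t • hw.basis a) → ⁅y, z⁆ = 0 := by
      intro y z hy hz
      refine hlie (hw.basis.ext fun a => ?_)
      obtain ⟨t, ht⟩ := hy a
      obtain ⟨r, hr⟩ := hz a
      rw [Module.End.mul_apply, Module.End.mul_apply, ht, hr, map_smul, map_smul, ht, hr, smul_comm]
    -- Commuting with `h₁ + (p + 1) h₂` forces an element to act diagonally in the rectangular
    -- basis, hence to commute with `h₁` and `h₂` separately.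
    have hker : LinearMap.ker (LieAlgebra.ad k g h₂) ⊓ LinearMap.ker (LieAlgebra.ad k g h₁) =
        LinearMap.ker (LieAlgebra.ad k g (h₁ + ((p : k) + 1) • h₂)) := by
      ext y
      simp only [Submodule.mem_inf, LinearMap.mem_ker, LieAlgebra.ad_apply]
      refine ⟨fun ⟨h, h'⟩ => by rw [add_lie, smul_lie, h, h', smul_zero, add_zero], fun h => ?_⟩
      exact ⟨hcomm _ _ (fun a => ⟨_, hH₂b a⟩) (hdiag y h),
        hcomm _ _ (fun a => ⟨_, hH₁b a⟩) (hdiag y h)⟩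
    -- First `e₁` is traded for `h₁` inside the centralizer of `e₂`, then `e₂` for `h₂` inside the
    -- centralizer of `h₁`. Each centralizer is stable under the other triple because the triples
    -- commute.
    rw [pairCentralizer, S₁.finrank_ker_inf_eq top₁ int₁ (lie_mem_ker_ad he.comm)
      (lie_mem_ker_ad h₁e₂) (lie_mem_ker_ad f₁e₂), inf_comm,
      S₂.finrank_ker_inf_eq top₂ int₂ (lie_mem_ker_ad (hsymm h₁e₂)) (lie_mem_ker_ad (hsymm hh))
        (lie_mem_ker_ad (hsymm h₁f₂)), hker]
    refine LieAlgebra.finrank_ker_ad_eq_rank ?_ fun a b ha hb => hcomm a b (hdiag a ha) (hdiag b hb)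
    refine isSemisimple_ad_of_diagonal (V := V) hw.basis (d := fun a =>
      ((a.1 : ℕ) : k) - p / 2 + ((p : k) + 1) * (((a.2 : ℕ) : k) - q / 2)) fun a => ?_
    rw [map_add, map_smul, LinearMap.add_apply, LinearMap.smul_apply, hH₁b, hH₂b]
    module

end

theorem proposition3 {k g V : Type*} [Field k] [IsAlgClosed k] [CharZero k]
    [LieRing g] [LieAlgebra k g] [FiniteDimensional k g] [LieAlgebra.IsSemisimple k g]
    [AddCommGroup V] [Module k V] [FiniteDimensional k V]
    [LieRingModule g V] [LieModule k g V] [LieModule.IsFaithful k g V]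
    (self_dual : Nonempty (V ≃ₗ⁅k,g⁆ Module.Dual k V))
    (e₁ e₂ : g) (he : IsNilpotentPair k e₁ e₂)
    (hfixed : Module.finrank k (pairFixed k V e₁ e₂) = 1) :
    IsRectangularPair k e₁ e₂ ∧ IsPrincipalPair k e₁ e₂ :=
  he.isRectangularPair_and_isPrincipalPair self_dual hfixed
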